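/- **Setting.** Let $(H,\langle\cdot,\cdot\rangle_H)$ be a separable real Hilbert space, and let $\mathcal H$ be the Hilbert space of self-adjoint Hilbert–Schmidt operators on $H$, with the inner product $\langle A,C\rangle=\sum_n\langle Ae_n,Ce_n\rangle_H$ ($(e_n)$ an orthonormal basis of $H$) and norm $\|\cdot\|$. Let $\mathcal H^+=\{A\in\mathcal H:\langle Ah,h\rangle_H\ge0\ \forall h\in H\}$, $\chi(x)=x\mathbf 1_{\{\|x\|\le1\}}$, and $(a\otimes a)h=\langle a,h\rangle_H\,a$ for $a,h\in H$. Write $iH$ for the purely imaginary part of the complexification $H+iH$, to which linear operators on $H$ extend complex-linearly and $\otimes$ extends complex-bilinearly; in particular $(ig)\otimes(ig)=-g\otimes g$ for $g\in H$. **Admissible parameters.** $(b,B,m,\mu)$ is *admissible* if 1. $b\in\mathcal H^+$; 2. $m$ is a Borel measure on $\mathcal H^+\setminus\{0\}$ with $\int\|\xi\|^2\,m(d\xi)<\infty$ and $\int|\langle\chi(\xi),h\rangle|\,m(d\xi)<\infty$ for all $h\in\mathcal H$; there is $I_m\in\mathcal H$ with $\langle I_m,h\rangle=\int\langle\chi(\xi),h\rangle\,m(d\xi)$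 for all $h\in\mathcal H$; and $\langle b,v\rangle-\int\langle\chi(\xi),v\rangle\,m(d\xi)\ge0$ for all $v\in\mathcal H^+$; 3. $\mu$ is a countably additive $\mathcal H^+$-valued measure on the Borel sets of $\mathcal H^+\setminus\{0\}$ such that $\int\langle\chi(\xi),u\rangle\frac{\langle\mu(d\xi),x\rangle}{\|\xi\|^2}<\infty$ for all $u,x\in\mathcal H^+$ with $\langle u,x\rangle=0$; 4. $B\in\mathcal L(\mathcal H)$, and its adjoint satisfies $\langle B^*(u),x\rangle-\int\langle\chi(\xi),u\rangle\frac{\langle\mu(d\xi),x\rangle}{\|\xi\|^2}\ge0$ for all $u,x\in\mathcal H^+$ with $\langle u,x\rangle=0$. For $D\in\mathcal L(H)$ positive and self-adjoint, $h\in iH$ and $u\in\mathcal H^+$ put $$F(u)=\langle b,u\rangle-\int_{\mathcal H^+\setminus\{0\}}\bigl(e^{-\langle\xi,u\rangle}-1+\langle\chi(\xi),u\rangle\bigr)\,m(d\xi),$$ $$R(h,u)=B^*(u)-\tfrac12D^{1/2}h\otimes D^{1/2}h-\int_{\mathcal H^+\setminus\{0\}}\bigl(e^{-\langle\xi,u\rangle}-1+\langle\chi(\xi),u\rangle\bigr)\frac{\mu(d\xi)}{\|\xi\|^2},$$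 where the last integral is the element of $\mathcal H$ whose inner product with each $x\in\mathcal H$ is the integral against the signed measure $\langle\mu(d\xi),x\rangle/\|\xi\|^2$. **Proposition.** Let $(b,B,m,\mu)$ be admissible, let $(\mathcal A,\operatorname{dom}\mathcal A)$ be the generator of a strongly continuous semigroup $(S(t))_{t\ge0}$ on $H$, with adjoint $\mathcal A^*$, and let $D\in\mathcal L(H)$ be positive and self-adjoint. Then for every $u=(u_1,u_2)\in iH\times\mathcal H^+$ and every $T\ge0$ there is exactly one triple of functions $\Phi\in C^1([0,T];[0,\infty))$, $\psi_1\in C([0,T];iH)$, $\psi_2\in C^1([0,T];\mathcal H^+)$ with $\Phi(0)=0$, $\psi_1(0)=u_1$, $\psi_2(0)=u_2$ such that for all $0<t\le T$ $$\Phi'(t)=F(\psi_2(t)),\qquad \psi_1(t)=u_1-i\mathcal A^*\Bigl(i\int_0^t\psi_1(s)\,ds\Bigr),\qquad \psi_2'(t)=R(\psi_1(t),\psi_2(t)),$$ where the second equation includes that $i\int_0^t\psi_1(s)\,ds$ lies in the domain of (the extension of) $\mathcal A^*$. This triple is called the mild solution on $[0,T]$ of the generalised Riccati equations. Moreover $\psi_1(t)=-i\,S(t)^*(iu_1)$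 for $t\in[0,T]$. -/

import Mathlib

open MeasureTheory Filter Topology Set
open scoped InnerProductSpace NNReal

noncomputable section

namespace AffineVol

variable (H : Type*) [NormedAddCommGroup H] [InnerProductSpace ℝ H] [CompleteSpace H]

/-- Index set of a fixed orthonormal (Hilbert) basis of `H`. -/
def BasisIndex : Set H := (exists_hilbertBasis ℝ H).choose

/-- A fixed orthonormal (Hilbert) basis of `H`. -/
def onb : HilbertBasis (BasisIndex H) ℝ H := (exists_hilbertBasis ℝ H).choose_spec.choose

/-- The subspace of `L(H)` of self-adjoint Hilbert-Schmidt operators. -/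
def selfAdjointHS : Submodule ℝ (H →L[ℝ] H) where
  carrier := {A | IsSelfAdjoint A ∧ Summable fun i => ‖A (onb H i)‖ ^ 2}
  zero_mem' := ⟨IsSelfAdjoint.zero _, by simp⟩
  add_mem' := by
    rintro A B ⟨hA, hA'⟩ ⟨hB, hB'⟩
    refine ⟨hA.add hB, ?_⟩
    refine Summable.of_nonneg_of_le (fun i => by positivity) (fun i => ?_)
      ((hA'.mul_left 2).add (hB'.mul_left 2))
    have h1 := norm_add_le (A (onb H i)) (B (onb H i))
    have h2 := norm_nonneg (A (onb H i) + B (onb H i))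
    simp only [_root_.add_apply]
    nlinarith [sq_nonneg (‖A (onb H i)‖ - ‖B (onb H i)‖)]
  smul_mem' := by
    rintro c A ⟨hA, hA'⟩
    refine ⟨(IsSelfAdjoint.all c).smul hA, ?_⟩
    simpa [norm_smul, mul_pow] using hA'.mul_left (c ^ 2)

/-- The space `ℋ` of self-adjoint Hilbert-Schmidt operators on `H`. It is a type of its own because it
carries the Hilbert-Schmidt inner product and norm, not the operator norm. -/
def SHS : Type _ := selfAdjointHS H

variable {H}

namespace SHS

instance : AddCommGroup (SHS H) := inferInstanceAs (AddCommGroup (selfAdjointHS H))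
instance : Module ℝ (SHS H) := inferInstanceAs (Module ℝ (selfAdjointHS H))

/-- The bounded operator underlying an element of `SHS H`. -/
def op : SHS H →ₗ[ℝ] (H →L[ℝ] H) := (selfAdjointHS H).subtype

theorem op_injective : Function.Injective (op (H := H)) := Subtype.coe_injective

theorem summable_sq (A : SHS H) : Summable fun i => ‖A.op (onb H i)‖ ^ 2 := A.2.2

theorem isSelfAdjoint (A : SHS H) : IsSelfAdjoint A.op := A.2.1

theorem summable_inner (A B : SHS H) :
    Summable fun i => ⟪A.op (onb H i), B.op (onb H i)⟫_ℝ := by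
  refine Summable.of_norm_bounded (A.summable_sq.add B.summable_sq) fun i => ?_
  refine (norm_inner_le_norm _ _).trans ?_
  nlinarith [sq_nonneg (‖A.op (onb H i)‖ - ‖B.op (onb H i)‖),
    sq_nonneg (‖A.op (onb H i)‖), sq_nonneg (‖B.op (onb H i)‖)]

theorem op_eq_zero_of_basis (A : SHS H) (h : ∀ i, A.op (onb H i) = 0) : A.op = 0 := by
  ext x
  rw [_root_.zero_apply, ← inner_self_eq_zero (𝕜 := ℝ),
    ← (onb H).tsum_inner_mul_inner (A.op x) (A.op x)]
  have key : ∀ i, ⟪A.op x, onb H i⟫_ℝ = 0 := fun i => by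
    rw [← ContinuousLinearMap.adjoint_inner_right, A.isSelfAdjoint.adjoint_eq, h i, inner_zero_right]
  simp [key]

/-- The Hilbert-Schmidt inner product `⟨A, B⟩ = ∑ ⟨A eᵢ, B eᵢ⟩`. -/
@[reducible] def core : InnerProductSpace.Core ℝ (SHS H) where
  inner A B := ∑' i, ⟪A.op (onb H i), B.op (onb H i)⟫_ℝ
  conj_inner_symm A B := by simp [real_inner_comm]
  re_inner_nonneg A := by
    simpa using tsum_nonneg fun i => real_inner_self_nonneg (x := A.op (onb H i))
  add_left A B C := by
    simp only [map_add, _root_.add_apply, inner_add_left]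
    exact (summable_inner A C).tsum_add (summable_inner B C)
  smul_left A B r := by
    simp only [map_smul, _root_.smul_apply, real_inner_smul_left, tsum_mul_left]
    simp
  definite A h := by
    apply op_injective
    rw [map_zero]
    apply op_eq_zero_of_basis
    intro i
    have h2 := (hasSum_zero_iff_of_nonneg
      (fun i => real_inner_self_nonneg (x := A.op (onb H i)))).1 (h ▸ (summable_inner A A).hasSum)
    simpa using congrFun h2 i

instance : NormedAddCommGroup (SHS H) := core.toNormedAddCommGroup
instance : InnerProductSpace ℝ (SHS H) := InnerProductSpace.ofCore core.toCore

theorem inner_def (A B : SHS H) : ⟪A, B⟫_ℝ = ∑' i, ⟪A.op (onb H i), B.op (onb H i)⟫_ℝ := rfl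

theorem norm_sq (A : SHS H) : ‖A‖ ^ 2 = ∑' i, ‖A.op (onb H i)‖ ^ 2 := by
  rw [← real_inner_self_eq_norm_sq, inner_def]
  simp

theorem norm_op_le (A : SHS H) : ‖A.op‖ ≤ ‖A‖ := by
  refine A.op.opNorm_le_bound (norm_nonneg _) fun x => ?_
  have h1 : HasSum (fun i => ⟪A.op x, onb H i⟫_ℝ * ⟪onb H i, A.op x⟫_ℝ) (‖A.op x‖ ^ 2) := by
    rw [← real_inner_self_eq_norm_sq]
    exact (onb H).hasSum_inner_mul_inner (A.op x) (A.op x)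
  have h2 : HasSum (fun i => ‖A.op (onb H i)‖ ^ 2 * ‖x‖ ^ 2) (‖A‖ ^ 2 * ‖x‖ ^ 2) := by
    rw [norm_sq]
    exact A.summable_sq.hasSum.mul_right _
  have h3 : ‖A.op x‖ ^ 2 ≤ ‖A‖ ^ 2 * ‖x‖ ^ 2 := by
    refine hasSum_le (fun i => ?_) h1 h2
    have h4 : ⟪A.op x, onb H i⟫_ℝ = ⟪x, A.op (onb H i)⟫_ℝ := by
      rw [← ContinuousLinearMap.adjoint_inner_right, A.isSelfAdjoint.adjoint_eq]
    rw [real_inner_comm (A.op x) (onb H i), h4, ← mul_pow, mul_comm ‖A.op (onb H i)‖, ← sq]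
    exact sq_le_sq' (by linarith [(abs_le.1 (abs_real_inner_le_norm x (A.op (onb H i)))).1])
      (real_inner_le_norm _ _)
  rw [← mul_pow] at h3
  exact le_of_sq_le_sq h3 (by positivity)

/-- The isometric embedding `A ↦ (A eᵢ)ᵢ` into the Hilbert sum of copies of `H`. -/
def toLp : SHS H →ₗᵢ[ℝ] lp (fun _ : BasisIndex H => H) 2 where
  toFun A := ⟨fun i => A.op (onb H i), by
    refine (memℓp_gen_iff (p := 2) (by norm_num)).2 ?_
    simpa using A.summable_sq⟩
  map_add' A B := by
    ext i
    change (A + B).op (onb H i) = A.op (onb H i) + B.op (onb H i)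
    simp
  map_smul' c A := by
    ext i
    change (c • A).op (onb H i) = c • A.op (onb H i)
    simp
  norm_map' A := by
    rw [← sq_eq_sq₀ (norm_nonneg _) (norm_nonneg _), norm_sq, ← real_inner_self_eq_norm_sq,
      lp.inner_eq_tsum]
    simp

theorem toLp_apply (A : SHS H) (i : BasisIndex H) : toLp A i = A.op (onb H i) := rfl

instance : CompleteSpace (SHS H) := by
  refine Metric.complete_of_cauchySeq_tendsto fun u hu => ?_
  have hop : CauchySeq fun n => (u n).op := by
    rw [Metric.cauchySeq_iff'] at hu ⊢
    intro ε hε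
    obtain ⟨N, hN⟩ := hu ε hε
    refine ⟨N, fun n hn => ?_⟩
    have := hN n hn
    rw [dist_eq_norm] at this ⊢
    rw [← map_sub]
    exact (norm_op_le _).trans_lt this
  obtain ⟨A, hA⟩ := cauchySeq_tendsto_of_complete hop
  have hlp : CauchySeq (fun n => toLp (u n)) :=
    (toLp (H := H)).isometry.uniformContinuous.comp_cauchySeq hu
  obtain ⟨f, hf⟩ := cauchySeq_tendsto_of_complete hlp
  have hAf : ∀ i, A (onb H i) = f i := fun i => by
    have h1 : Tendsto (fun n => (u n).op (onb H i)) atTop (𝓝 (A (onb H i))) :=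
      ((ContinuousLinearMap.apply ℝ H (onb H i)).continuous.tendsto A).comp hA
    have h2 : Tendsto (fun n => (toLp (u n)) i) atTop (𝓝 (f i)) :=
      ((lp.evalCLM ℝ (fun _ : BasisIndex H => H) 2 i).continuous.tendsto f).comp hf
    exact tendsto_nhds_unique h1 h2
  have hsa : IsSelfAdjoint A :=
    (isClosed_eq continuous_star continuous_id).mem_of_tendsto hA
      (Eventually.of_forall fun n => (u n).isSelfAdjoint)
  have hsum : Summable fun i => ‖A (onb H i)‖ ^ 2 := by
    have := (memℓp_gen_iff (p := 2) (by norm_num)).1 (lp.memℓp f)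
    simpa [hAf] using this
  let a : SHS H := (⟨A, hsa, hsum⟩ : selfAdjointHS H)
  have ha : toLp a = f := by
    ext i
    exact hAf i
  refine ⟨a, ?_⟩
  rw [toLp.isometry.isEmbedding.tendsto_nhds_iff, ha]
  exact hf

instance : MeasurableSpace (SHS H) := borel (SHS H)
instance : BorelSpace (SHS H) := ⟨rfl⟩

end SHS

/-- The cone `ℋ⁺` of positive operators in `ℋ`. -/
def posCone (H : Type*) [NormedAddCommGroup H] [InnerProductSpace ℝ H] [CompleteSpace H] :
    Set (SHS H) :=
  {A | ∀ h : H, 0 ≤ ⟪A.op h, h⟫_ℝ}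

/-- The punctured cone `ℋ⁺ \ {0}`, with the trace of the Borel `σ`-algebra of `ℋ`. -/
abbrev Jump (H : Type*) [NormedAddCommGroup H] [InnerProductSpace ℝ H] [CompleteSpace H] : Type _ :=
  {ξ : SHS H // ξ ∈ posCone H ∧ ξ ≠ 0}

open Classical in
/-- The truncation function `χ(x) = x 1_{‖x‖ ≤ 1}`. -/
def chi (x : SHS H) : SHS H := if ‖x‖ ≤ 1 then x else 0

/-- `a ⊗ a ∈ ℋ`, the operator `h ↦ ⟨a, h⟩ a`. -/
def tensorSq (a : H) : SHS H :=
  (⟨InnerProductSpace.rankOne ℝ a a,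
    (InnerProductSpace.isPositive_rankOne_self (𝕜 := ℝ) a).isSelfAdjoint, by
      have h := ((onb H).summable_inner_mul_inner a a).mul_right (‖a‖ ^ 2)
      refine h.congr fun i => ?_
      rw [InnerProductSpace.rankOne_apply, norm_smul, mul_pow, real_inner_comm a (onb H i),
        Real.norm_eq_abs, sq_abs, sq (inner ℝ a _)]⟩ : selfAdjointHS H)

theorem tensorSq_op_apply (a h : H) : (tensorSq a).op h = ⟪a, h⟫_ℝ • a := rfl

/-! ### Integration against an `ℋ`-valued measure -/

/-- The signed measure `⟨μ(dξ), x⟩`. -/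
def pairing (μ : VectorMeasure (Jump H) (SHS H)) (x : SHS H) : SignedMeasure (Jump H) :=
  μ.mapRange (innerSL ℝ x).toLinearMap.toAddMonoidHom (innerSL ℝ x).continuous

theorem pairing_apply (μ : VectorMeasure (Jump H) (SHS H)) (x : SHS H) (s : Set (Jump H)) :
    pairing μ x s = ⟪μ s, x⟫_ℝ := by
  rw [real_inner_comm]
  rfl

open VectorMeasure in
/-- `I = ∫ f(ξ) μ(dξ)` in the weak sense: `f` is integrable against every signed measure
`⟨μ(dξ), x⟩`, and `⟨I, x⟩ = ∫ f(ξ) ⟨μ(dξ), x⟩`. -/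
def HasWeakIntegral (μ : VectorMeasure (Jump H) (SHS H)) (f : Jump H → ℝ) (I : SHS H) : Prop :=
  ∀ x : SHS H, (pairing μ x).Integrable f ∧
    ⟪I, x⟫_ℝ = (pairing μ x).integral f (ContinuousLinearMap.lsmul ℝ ℝ)

theorem HasWeakIntegral.unique {μ : VectorMeasure (Jump H) (SHS H)} {f : Jump H → ℝ} {I J : SHS H}
    (hI : HasWeakIntegral μ f I) (hJ : HasWeakIntegral μ f J) : I = J :=
  ext_inner_right ℝ fun x => (hI x).2.trans (hJ x).2.symm

theorem tendsto_continuousLinear {E : Type*} [NormedAddCommGroup E] [NormedSpace ℝ E]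
    [CompleteSpace E] {g : ℕ → E →L[ℝ] ℝ} {f : E → ℝ}
    (h : ∀ x, Tendsto (fun n => g n x) atTop (𝓝 (f x))) : ∃ L : E →L[ℝ] ℝ, ∀ x, L x = f x :=
  ⟨continuousLinearMapOfTendsto g (tendsto_pi_nhds.2 h), fun _ => rfl⟩

/-- A measurable function that is integrable against every `⟨μ(dξ), x⟩` has a weak integral. -/
theorem exists_hasWeakIntegral {μ : VectorMeasure (Jump H) (SHS H)} {f : Jump H → ℝ}
    (hf : Measurable f) (hint : ∀ x, (pairing μ x).Integrable f) : ∃ I, HasWeakIntegral μ f I := by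
  have hfin : ∀ x, IsFiniteMeasure (pairing μ x).variation := fun x => by
    rw [← SignedMeasure.totalVariation_eq_variation]
    unfold SignedMeasure.totalVariation
    infer_instance
  have hsimple : ∀ g : SimpleFunc (Jump H) ℝ, ∃ I : SHS H, ∀ x,
      ⟪I, x⟫_ℝ = (pairing μ x).integral g (ContinuousLinearMap.lsmul ℝ ℝ) := by
    intro g
    induction g using SimpleFunc.induction with
    | @const c s hs =>
      refine ⟨c • μ s, fun x => ?_⟩
      have hcoe : ⇑(SimpleFunc.piecewise s hs (SimpleFunc.const (Jump H) c)
          (SimpleFunc.const (Jump H) 0)) = s.indicator fun _ => c := by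
        ext ξ
        by_cases hξ : ξ ∈ s <;> simp [hξ]
      rw [hcoe, VectorMeasure.integral_eq_setToFun]
      refine Eq.trans ?_ (setToFun_indicator_const _ hs (measure_ne_top _ _) c).symm
      change _ = c * pairing μ x s
      rw [pairing_apply, real_inner_smul_left]
    | @add g₁ g₂ _ h₁ h₂ =>
      obtain ⟨I₁, hI₁⟩ := h₁
      obtain ⟨I₂, hI₂⟩ := h₂
      refine ⟨I₁ + I₂, fun x => ?_⟩
      rw [SimpleFunc.coe_add, VectorMeasure.integral_add (SimpleFunc.integrable_of_isFiniteMeasure _)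
        (SimpleFunc.integrable_of_isFiniteMeasure _), inner_add_left, hI₁, hI₂]
  choose I hI using fun n => hsimple (SimpleFunc.approxOn f hf univ 0 (mem_univ 0) n)
  have hlim : ∀ x, Tendsto (fun n => innerSL ℝ (I n) x) atTop
      (𝓝 ((pairing μ x).integral f (ContinuousLinearMap.lsmul ℝ ℝ))) := by
    intro x
    simp only [innerSL_apply_apply, hI]
    refine VectorMeasure.tendsto_integral_of_L1 f hf.aestronglyMeasurable
      (Eventually.of_forall fun n => SimpleFunc.integrable_of_isFiniteMeasure _) ?_
    refine SimpleFunc.tendsto_approxOn_L1_enorm hf (mem_univ 0) (by simp) ?_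
    simpa using (hint x).hasFiniteIntegral
  obtain ⟨L, hL⟩ := tendsto_continuousLinear hlim
  refine ⟨(InnerProductSpace.toDual ℝ (SHS H)).symm L, fun x => ⟨hint x, ?_⟩⟩
  rw [InnerProductSpace.toDual_symm_apply, hL]

open Classical in
/-- The integral `∫ f(ξ) μ(dξ) ∈ ℋ` (and `0` if it does not exist). -/
def weakIntegral (μ : VectorMeasure (Jump H) (SHS H)) (f : Jump H → ℝ) : SHS H :=
  if h : ∃ I, HasWeakIntegral μ f I then h.choose else 0

theorem HasWeakIntegral.weakIntegral_eq {μ : VectorMeasure (Jump H) (SHS H)} {f : Jump H → ℝ}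
    {I : SHS H} (hI : HasWeakIntegral μ f I) : weakIntegral μ f = I := by
  have h : ∃ I, HasWeakIntegral μ f I := ⟨I, hI⟩
  rw [weakIntegral, dif_pos h]
  exact h.choose_spec.unique hI

/-! ### Admissible parameters -/

/-- Admissible parameter sets `(b, B, m, μ)`. The measure `μ` is a countably additive `ℋ`-valued set
function whose values lie in `ℋ⁺`, so that `⟨μ(dξ), x⟩` is a finite positive measure for every
`x ∈ ℋ⁺`. -/
structure IsAdmissible (b : SHS H) (B : SHS H →L[ℝ] SHS H) (m : Measure (Jump H))
    (μ : VectorMeasure (Jump H) (SHS H)) : Prop where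
  b_mem : b ∈ posCone H
  m_sq : Integrable (fun ξ : Jump H => ‖ξ.1‖ ^ 2) m
  m_chi : ∀ h : SHS H, Integrable (fun ξ : Jump H => ⟪chi ξ.1, h⟫_ℝ) m
  m_mean : ∃ Im : SHS H, ∀ h : SHS H, ⟪Im, h⟫_ℝ = ∫ ξ : Jump H, ⟪chi ξ.1, h⟫_ℝ ∂m
  b_ge : ∀ v ∈ posCone H, 0 ≤ ⟪b, v⟫_ℝ - ∫ ξ : Jump H, ⟪chi ξ.1, v⟫_ℝ ∂m
  mu_mem : ∀ s : Set (Jump H), μ s ∈ posCone H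
  mu_chi : ∀ u ∈ posCone H, ∀ x ∈ posCone H, ⟪u, x⟫_ℝ = 0 →
    (pairing μ x).Integrable fun ξ => ⟪chi ξ.1, u⟫_ℝ / ‖ξ.1‖ ^ 2
  B_ge : ∀ u ∈ posCone H, ∀ x ∈ posCone H, ⟪u, x⟫_ℝ = 0 →
    0 ≤ ⟪ContinuousLinearMap.adjoint B u, x⟫_ℝ -
      (pairing μ x).integral (fun ξ => ⟪chi ξ.1, u⟫_ℝ / ‖ξ.1‖ ^ 2) (ContinuousLinearMap.lsmul ℝ ℝ)

/-! ### Strongly continuous semigroups -/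

/-- A strongly continuous semigroup of bounded operators on `H`. -/
structure C0Semigroup (H : Type*) [NormedAddCommGroup H] [InnerProductSpace ℝ H] where
  /-- The operators `S(t)`, `t ≥ 0`. -/
  toFun : ℝ≥0 → H →L[ℝ] H
  map_zero : toFun 0 = ContinuousLinearMap.id ℝ H
  map_add : ∀ s t, toFun (s + t) = toFun s ∘L toFun t
  continuous : ∀ x, Continuous fun t => toFun t x

/-- `(A, dom A)` is the generator of the semigroup `S`: `x ∈ dom A` and `A x = y` if and only if
`(S(t) x - x) / t → y` as `t ↓ 0`. -/
def C0Semigroup.IsGenerator (S : C0Semigroup H) (A : H →ₗ.[ℝ] H) : Prop :=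
  ∀ x y : H, (x, y) ∈ A.graph ↔
    Tendsto (fun t : ℝ≥0 => (t : ℝ)⁻¹ • (S.toFun t x - x)) (𝓝[≠] 0) (𝓝 y)

/-! ### The complexification of `H` -/

/-- The complexification `H + iH` of `H`; the pair `(x, y)` stands for `x + iy`. Only its structure
of a real topological vector space and the maps below are used. -/
abbrev Cplx (H : Type*) : Type _ := H × H

/-- Multiplication by the imaginary unit, `i(x + iy) = -y + ix`. -/
def mulI (z : Cplx H) : Cplx H := (-z.2, z.1)

/-- The subspace `iH` of purely imaginary vectors. -/
def imag (H : Type*) [NormedAddCommGroup H] : Set (Cplx H) := {z | z.1 = 0}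

/-- The complex linear extension `L(x + iy) = Lx + iLy` of a bounded operator. -/
def extend (L : H →L[ℝ] H) (z : Cplx H) : Cplx H := (L z.1, L z.2)

/-- For an unbounded operator `A`: `z` belongs to the domain `dom A + i dom A` of the complex linear
extension of `A`, and this extension maps `z` to `w`. -/
def ExtendGraph (A : H →ₗ.[ℝ] H) (z w : Cplx H) : Prop :=
  (z.1, w.1) ∈ A.graph ∧ (z.2, w.2) ∈ A.graph

/-- The (real part of the) complex bilinear square
`(x + iy) ⊗ (x + iy) = x ⊗ x - y ⊗ y + i (x ⊗ y + y ⊗ x)`;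
its imaginary part vanishes if `x + iy` is purely imaginary. -/
def tensorSqC (z : Cplx H) : SHS H := tensorSq z.1 - tensorSq z.2

open Classical in
/-- The positive self-adjoint square root `D^{1/2}` of a positive self-adjoint bounded operator
`D`, which exists and is unique by the classical square root theorem. -/
def sqrtOp (D : H →L[ℝ] H) : H →L[ℝ] H :=
  if h : ∃ R : H →L[ℝ] H, R.IsPositive ∧ R ∘L R = D then h.choose else 0

/-! ### The generalised Riccati equations -/

/-- `F(u) = ⟨b, u⟩ - ∫ (exp(-⟨ξ, u⟩) - 1 + ⟨χ(ξ), u⟩) m(dξ)`. -/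
def riccatiF (b : SHS H) (m : Measure (Jump H)) (u : SHS H) : ℝ :=
  ⟪b, u⟫_ℝ - ∫ ξ : Jump H, (Real.exp (-⟪ξ.1, u⟫_ℝ) - 1 + ⟪chi ξ.1, u⟫_ℝ) ∂m

/-- `R(h, u) = B^*(u) - ½ D^{1/2}h ⊗ D^{1/2}h
  - ∫ (exp(-⟨ξ, u⟩) - 1 + ⟨χ(ξ), u⟩) ‖ξ‖⁻² μ(dξ)`. -/
def riccatiR (B : SHS H →L[ℝ] SHS H) (D : H →L[ℝ] H) (μ : VectorMeasure (Jump H) (SHS H))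
    (h : Cplx H) (u : SHS H) : SHS H :=
  ContinuousLinearMap.adjoint B u - (1 / 2 : ℝ) • tensorSqC (extend (sqrtOp D) h) -
    weakIntegral μ fun ξ =>
      (Real.exp (-⟪ξ.1, u⟫_ℝ) - 1 + ⟪chi ξ.1, u⟫_ℝ) / ‖ξ.1‖ ^ 2

open LinearPMap in
/-- Mild solutions `(Φ, ψ₁, ψ₂)` on `[0, T]` of the generalised Riccati equations with initial value
`(0, u₁, u₂)`:
`Φ' = F(ψ₂)`, `ψ₁(t) = u₁ - i A^*(i ∫₀ᵗ ψ₁(s) ds)`, `ψ₂' = R(ψ₁, ψ₂)`. -/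
structure IsMildSolution (b : SHS H) (B : SHS H →L[ℝ] SHS H) (m : Measure (Jump H))
    (μ : VectorMeasure (Jump H) (SHS H)) (A : H →ₗ.[ℝ] H) (D : H →L[ℝ] H)
    (u₁ : Cplx H) (u₂ : SHS H) (T : ℝ)
    (Φ : ℝ → ℝ) (ψ₁ : ℝ → Cplx H) (ψ₂ : ℝ → SHS H) : Prop where
  Phi_C1 : ContDiffOn ℝ 1 Φ (Icc 0 T)
  Phi_nonneg : ∀ t ∈ Icc 0 T, 0 ≤ Φ t
  Phi_zero : Φ 0 = 0
  Phi_eq : ∀ t ∈ Ioc 0 T, HasDerivWithinAt Φ (riccatiF b m (ψ₂ t)) (Icc 0 T) t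
  psi₁_cont : ContinuousOn ψ₁ (Icc 0 T)
  psi₁_mem : ∀ t ∈ Icc 0 T, ψ₁ t ∈ imag H
  psi₁_zero : ψ₁ 0 = u₁
  psi₁_eq : ∀ t ∈ Ioc 0 T, ∃ w, ExtendGraph A† (mulI (∫ s in (0 : ℝ)..t, ψ₁ s)) w ∧
    ψ₁ t = u₁ - mulI w
  psi₂_C1 : ContDiffOn ℝ 1 ψ₂ (Icc 0 T)
  psi₂_mem : ∀ t ∈ Icc 0 T, ψ₂ t ∈ posCone H
  psi₂_zero : ψ₂ 0 = u₂
  psi₂_eq : ∀ t ∈ Ioc 0 T, HasDerivWithinAt ψ₂ (riccatiR B D μ (ψ₁ t) (ψ₂ t)) (Icc 0 T) t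

end AffineVol

end

/-!
The equations decouple. The second one does not involve `Φ` and `ψ₂`, the third one is then a
differential equation `ψ₂' = R(ψ₁(t), ψ₂)` in the cone `ℋ⁺`, and `Φ` is the primitive of `F(ψ₂)`,
which is nonnegative and continuous because `F` is so on `ℋ⁺`.

*The equation for `ψ₁`.* For `u₁ = i g` it says that `ψ₁ = i φ` with `φ(t) = g + A^* ∫₀ᵗ φ`. On a
Hilbert space the adjoint semigroup is again strongly continuous
(`C0Semigroup.continuous_adjoint_evol`): the averages `∫₀ʳ S(s)^* x ds` are points of continuity, and
a vector orthogonal to all of them is annihilated by all `∫₀ʳ S(s) ds`, hence is zero. So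
`φ(t) = S(t)^* g` is a solution, and it is the only one since for the difference `δ` of two solutions
`s ↦ ⟨S(t - s) a, ∫₀ˢ δ⟩` is constant for `a ∈ dom A` (`C0Semigroup.IsGenerator.eq_zero_of_mild`).

*The equation for `ψ₂`.* The cone `ℋ⁺` is self-dual (`isSelfDual_posCone`), and on it the vector
field `R(ψ₁(t), ·)` is locally Lipschitz, quasi-monotone (for orthogonal `u, x ∈ ℋ⁺` one has
`⟨R(ψ₁(t), u), x⟩ ≥ 0`) and satisfies `⟨R(ψ₁(t), u), u⟩ ≤ C (1 + ‖u‖²)`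
(`IsAdmissible.isConeField`). Quasi-monotonicity is the admissibility condition on `B` and `μ`; the
growth bound holds because the jump integral of the small jumps enters with a negative sign. Such
equations are uniquely solvable in any self-dual cone `K` (`IsConeField.exists_solution`,
`IsConeField.eqOn_of_solution`): the field is extended to the whole space by composing it with the
metric projection `P` onto `K` and with the retraction onto a large ball, and the theorem of
Picard-Lindelöf applies. By Moreau's decomposition and quasi-monotonicity the squared distance
`‖P y - y‖²` to the cone cannot increase along a solution, and by the growth bound the solution does
not leave the ball.
-/

namespace AffineVol

/-! ### Self-dual cones and their metric projections -/

section Cone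

variable {E : Type*} [NormedAddCommGroup E] [InnerProductSpace ℝ E]

/-- `K` is its own dual cone for the inner product of `E`. In particular `K` is a closed convex
cone. -/
def IsSelfDual (K : Set E) : Prop := ∀ x, x ∈ K ↔ ∀ y ∈ K, 0 ≤ ⟪x, y⟫_ℝ

/-- `P` is the metric projection onto the self-dual cone `K`, described by Moreau's decomposition
`u = P u - (P u - u)` of `u` into two orthogonal parts of which one is in `K` and the other in
`-K`. -/
structure IsConeProj (K : Set E) (P : E → E) : Prop where
  mem : ∀ u, P u ∈ K
  sub_mem : ∀ u, P u - u ∈ K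
  orth : ∀ u, ⟪P u, P u - u⟫_ℝ = 0

namespace IsSelfDual

variable {K : Set E}

theorem inner_nonneg (hK : IsSelfDual K) {x y : E} (hx : x ∈ K) (hy : y ∈ K) : 0 ≤ ⟪x, y⟫_ℝ :=
  (hK x).1 hx y hy

theorem zero_mem (hK : IsSelfDual K) : (0 : E) ∈ K := (hK 0).2 fun y _ => by simp

theorem smul_mem (hK : IsSelfDual K) {c : ℝ} (hc : 0 ≤ c) {x : E} (hx : x ∈ K) : c • x ∈ K :=
  (hK _).2 fun y hy => by
    rw [real_inner_smul_left]
    exact mul_nonneg hc (hK.inner_nonneg hx hy)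

theorem add_mem (hK : IsSelfDual K) {x y : E} (hx : x ∈ K) (hy : y ∈ K) : x + y ∈ K :=
  (hK _).2 fun z hz => by
    rw [inner_add_left]
    exact add_nonneg (hK.inner_nonneg hx hz) (hK.inner_nonneg hy hz)

theorem convex (hK : IsSelfDual K) : Convex ℝ K := fun _ hx _ hy _ _ ha hb _ =>
  hK.add_mem (hK.smul_mem ha hx) (hK.smul_mem hb hy)

theorem isClosed (hK : IsSelfDual K) : IsClosed K := by
  have : K = ⋂ y ∈ K, {x | 0 ≤ ⟪x, y⟫_ℝ} := by
    ext x
    simpa using hK x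
  rw [this]
  exact isClosed_biInter fun y _ => isClosed_le continuous_const (by fun_prop)

theorem exists_isConeProj [CompleteSpace E] (hK : IsSelfDual K) : ∃ P : E → E, IsConeProj K P := by
  have h : ∀ u : E, ∃ v ∈ K, v - u ∈ K ∧ ⟪v, v - u⟫_ℝ = 0 := fun u => by
    obtain ⟨v, hv, hmin⟩ := exists_norm_eq_iInf_of_complete_convex ⟨0, hK.zero_mem⟩
      hK.isClosed.isComplete hK.convex u
    have hle := (norm_eq_iInf_iff_real_inner_le_zero hK.convex hv).1 hmin
    have h0 := hle 0 hK.zero_mem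
    have h2 := hle ((2 : ℝ) • v) (hK.smul_mem two_pos.le hv)
    rw [two_smul, add_sub_cancel_right] at h2
    rw [zero_sub, inner_neg_right] at h0
    have h3 : ⟪u - v, v⟫_ℝ = 0 := by linarith
    refine ⟨v, hv, (hK _).2 fun w hw => ?_, ?_⟩
    · have := hle w hw
      rw [inner_sub_right, h3] at this
      rw [← neg_sub, inner_neg_left]
      linarith
    · rw [← neg_sub, inner_neg_right, real_inner_comm, h3, neg_zero]
  choose P h1 h2 h3 using h
  exact ⟨P, h1, h2, h3⟩

end IsSelfDual

namespace IsConeProj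

variable {K : Set E} {P : E → E}

theorem apply_eq_iff (hK : IsSelfDual K) (hP : IsConeProj K P) (u : E) : P u = u ↔ u ∈ K := by
  refine ⟨fun h => h ▸ hP.mem u, fun hu => ?_⟩
  have h1 := hK.inner_nonneg hu (hP.sub_mem u)
  have h2 : ⟪P u - u, P u - u⟫_ℝ = - ⟪u, P u - u⟫_ℝ := by
    rw [inner_sub_left, hP.orth, zero_sub]
  have h3 : ⟪P u - u, P u - u⟫_ℝ = 0 := le_antisymm (by linarith) real_inner_self_nonneg
  exact sub_eq_zero.1 (inner_self_eq_zero.1 h3)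

theorem norm_sub_sq_le (hK : IsSelfDual K) (hP : IsConeProj K P) (u v : E) :
    ‖P u - P v‖ ^ 2 ≤ ⟪P u - P v, u - v⟫_ℝ := by
  have h1 := hK.inner_nonneg (hP.mem u) (hP.sub_mem v)
  have h2 := hK.inner_nonneg (hP.mem v) (hP.sub_mem u)
  have h3 := hP.orth u
  have h4 := hP.orth v
  rw [← real_inner_self_eq_norm_sq]
  simp only [inner_sub_left, inner_sub_right] at *
  linarith

theorem lipschitzWith (hK : IsSelfDual K) (hP : IsConeProj K P) : LipschitzWith 1 P := by
  refine LipschitzWith.of_dist_le_mul fun u v => ?_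
  rw [dist_eq_norm, dist_eq_norm, NNReal.coe_one, one_mul]
  have h1 := (norm_sub_sq_le hK hP u v).trans (real_inner_le_norm _ _)
  by_contra! h
  nlinarith [norm_nonneg (u - v), norm_nonneg (P u - P v)]

/-- The squared distance to the cone is differentiable, with gradient `-2 (P u - u)`. -/
theorem hasFDerivAt_norm_sq (hK : IsSelfDual K) (hP : IsConeProj K P) (u : E) :
    HasFDerivAt (fun u => ‖P u - u‖ ^ 2) (-(2 : ℝ) • innerSL ℝ (P u - u)) u := by
  refine HasFDerivAt.of_isLittleO ((Asymptotics.IsBigO.of_bound 1 (Eventually.of_forall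
    fun v => ?_)).trans_isLittleO (Asymptotics.isLittleO_pow_sub_sub u one_lt_two))
  have h1 := hK.inner_nonneg (hP.mem u) (hP.sub_mem v)
  have h2 := hK.inner_nonneg (hP.mem v) (hP.sub_mem u)
  have h3 := hP.orth u
  have h4 := hP.orth v
  have h5 := real_inner_self_nonneg (x := P v - P u)
  have h6 := real_inner_self_nonneg (x := (P v - P u) - (v - u))
  have h7 := real_inner_comm u v
  have h8 := real_inner_comm (P u) (P v)
  have h9 := real_inner_comm (P u) u
  have h10 := real_inner_comm (P u) v
  have h11 := real_inner_comm (P v) u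
  have h12 := real_inner_comm (P v) v
  rw [one_mul, norm_pow, norm_norm, Real.norm_eq_abs, abs_le]
  simp only [_root_.smul_apply, innerSL_apply_apply, smul_eq_mul, ← real_inner_self_eq_norm_sq]
  simp only [inner_sub_left, inner_sub_right] at *
  constructor <;> linarith

/-- A differentiable curve that starts in the cone stays there if its velocity never points away
from the cone: the squared distance to the cone does not increase along such a curve. -/
theorem mem_of_hasDerivWithinAt (hK : IsSelfDual K) (hP : IsConeProj K P) {T : ℝ}
    {y v : ℝ → E} (h0 : y 0 ∈ K)
    (hy : ∀ t ∈ Icc 0 T, HasDerivWithinAt y (v t) (Icc 0 T) t)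
    (hv : ∀ t ∈ Icc 0 T, 0 ≤ ⟪P (y t) - y t, v t⟫_ℝ) :
    ∀ t ∈ Icc 0 T, y t ∈ K := by
  have hder : ∀ t ∈ Icc 0 T, HasDerivWithinAt (fun t => ‖P (y t) - y t‖ ^ 2)
      (-2 * ⟪P (y t) - y t, v t⟫_ℝ) (Icc 0 T) t := fun t ht => by
    have h := (hasFDerivAt_norm_sq hK hP (y t)).comp_hasDerivWithinAt t (hy t ht)
    rwa [_root_.smul_apply, innerSL_apply_apply, smul_eq_mul] at h
  have hanti : AntitoneOn (fun t => ‖P (y t) - y t‖ ^ 2) (Icc 0 T) := by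
    refine antitoneOn_of_hasDerivWithinAt_nonpos (convex_Icc 0 T)
      (fun t ht => (hder t ht).continuousWithinAt)
      (fun t ht => (hder t (interior_subset ht)).mono interior_subset) fun t ht => ?_
    have := hv t (interior_subset ht)
    linarith
  intro t ht
  have h1 := hanti ⟨le_rfl, ht.1.trans ht.2⟩ ht ht.1
  have h2 : ‖P (y t) - y t‖ ^ 2 = 0 := by
    refine le_antisymm ?_ (sq_nonneg _)
    simpa [(hP.apply_eq_iff hK _).2 h0] using h1
  exact (hP.apply_eq_iff hK _).1 (sub_eq_zero.1 (norm_eq_zero.1 (pow_eq_zero_iff two_ne_zero |>.1 h2)))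

end IsConeProj

end Cone

/-! ### Ordinary differential equations in a self-dual cone -/

section ODE

variable {E : Type*} [NormedAddCommGroup E] [InnerProductSpace ℝ E]

/-- The radial retraction onto the closed ball of radius `M`. -/
noncomputable def radial (M : ℝ) (u : E) : E := (M / max M ‖u‖) • u

theorem radial_of_norm_le {M : ℝ} (hM : 0 < M) {u : E} (hu : ‖u‖ ≤ M) : radial M u = u := by
  rw [radial, max_eq_left hu, div_self hM.ne', one_smul]

theorem norm_radial_le {M : ℝ} (hM : 0 < M) (u : E) : ‖radial M u‖ ≤ M := by
  have h : 0 < max M ‖u‖ := lt_max_of_lt_left hM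
  rw [radial, norm_smul, Real.norm_of_nonneg (by positivity), div_mul_eq_mul_div,
    div_le_iff₀ h]
  gcongr
  exact le_max_right _ _

theorem lipschitzWith_radial {M : ℝ} (hM : 0 < M) : LipschitzWith 2 (radial M : E → E) := by
  refine LipschitzWith.of_dist_le_mul fun u v => ?_
  rw [dist_eq_norm, dist_eq_norm]
  have hu : 0 < max M ‖u‖ := lt_max_of_lt_left hM
  have hv : 0 < max M ‖v‖ := lt_max_of_lt_left hM
  have h1 : radial M u - radial M v
      = (M / max M ‖u‖) • (u - v) + (M / max M ‖u‖ - M / max M ‖v‖) • v := by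
    rw [radial, radial, smul_sub, sub_smul]
    abel
  have h2 : M / max M ‖u‖ ≤ 1 := (div_le_one hu).2 (le_max_left _ _)
  have h3 : ‖v‖ / max M ‖v‖ ≤ 1 := (div_le_one hv).2 (le_max_right _ _)
  have h4 : |max M ‖v‖ - max M ‖u‖| ≤ ‖u - v‖ := by
    refine (abs_max_sub_max_le_max M ‖v‖ M ‖u‖).trans ?_
    rw [sub_self, abs_zero, max_eq_right (abs_nonneg _), norm_sub_rev u v]
    exact abs_norm_sub_norm_le v u
  have h5 : ‖(M / max M ‖u‖ - M / max M ‖v‖) • v‖ ≤ ‖u - v‖ := by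
    have h6 : M / max M ‖u‖ - M / max M ‖v‖
        = M / max M ‖u‖ * (1 / max M ‖v‖) * (max M ‖v‖ - max M ‖u‖) := by
      field_simp
    rw [norm_smul, h6, norm_mul, norm_mul, Real.norm_of_nonneg (by positivity : 0 ≤ M / max M ‖u‖),
      Real.norm_of_nonneg (by positivity : 0 ≤ 1 / max M ‖v‖), Real.norm_eq_abs]
    calc M / max M ‖u‖ * (1 / max M ‖v‖) * |max M ‖v‖ - max M ‖u‖| * ‖v‖
        = (M / max M ‖u‖) * (‖v‖ / max M ‖v‖) * |max M ‖v‖ - max M ‖u‖| := by ring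
      _ ≤ 1 * 1 * ‖u - v‖ := by gcongr
      _ = ‖u - v‖ := by ring
  rw [h1]
  refine (norm_add_le _ _).trans ?_
  rw [norm_smul, Real.norm_of_nonneg (by positivity : 0 ≤ M / max M ‖u‖)]
  have := mul_le_mul_of_nonneg_right h2 (norm_nonneg (u - v))
  push_cast
  linarith

/-- The hypotheses under which the equation `y' = G t y` is solvable in the cone `K`:
`G` is continuous in time, locally Lipschitz on `K`, quasi-monotone (it points into `K` at the
boundary of `K`), and satisfies a one-sided linear growth bound. -/
structure IsConeField (K : Set E) (G : ℝ → E → E) (T : ℝ) : Prop where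
  continuous : ∀ u ∈ K, Continuous fun t => G t u
  lipschitz : ∀ M : ℝ, ∃ L : ℝ≥0, ∀ t, LipschitzOnWith L (G t) (K ∩ Metric.closedBall 0 M)
  quasimonotone : ∀ t ∈ Icc 0 T, ∀ u ∈ K, ∀ x ∈ K, ⟪u, x⟫_ℝ = 0 → 0 ≤ ⟪G t u, x⟫_ℝ
  growth : ∃ C : ℝ, 0 ≤ C ∧ ∀ t ∈ Icc 0 T, ∀ u ∈ K, ⟪G t u, u⟫_ℝ ≤ C * (1 + ‖u‖ ^ 2)

variable {K : Set E} {G : ℝ → E → E} {T : ℝ}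

/-- The growth bound survives the truncation of the argument by the radial retraction, with a
constant that does not depend on the radius. -/
theorem inner_radial_le {C M : ℝ} (hC : 0 ≤ C) (hM : 1 ≤ M) {g : E → E}
    {u : E} (hg : ⟪g (radial M u), radial M u⟫_ℝ ≤ C * (1 + ‖radial M u‖ ^ 2)) :
    ⟪g (radial M u), u⟫_ℝ ≤ 2 * C * (1 + ‖u‖ ^ 2) := by
  have hM0 : 0 < M := zero_lt_one.trans_le hM
  rcases le_total ‖u‖ M with hu | hu
  · rw [radial_of_norm_le hM0 hu] at *
    nlinarith [sq_nonneg ‖u‖, mul_nonneg hC (sq_nonneg ‖u‖)]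
  · have hu0 : 0 < ‖u‖ := hM0.trans_le hu
    have hr := norm_radial_le hM0 u
    have h1 : ⟪g (radial M u), u⟫_ℝ = ‖u‖ / M * ⟪g (radial M u), radial M u⟫_ℝ := by
      rw [← real_inner_smul_right]
      congr 1
      rw [radial, max_eq_right hu, smul_smul, div_mul_div_cancel₀ hM0.ne', div_self hu0.ne',
        one_smul]
    have h2 : 1 + ‖radial M u‖ ^ 2 ≤ 2 * M ^ 2 := by
      nlinarith [norm_nonneg (radial M u)]
    calc ⟪g (radial M u), u⟫_ℝ ≤ ‖u‖ / M * (C * (2 * M ^ 2)) := by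
          rw [h1]
          gcongr
          exact hg.trans (by gcongr)
      _ = 2 * C * (‖u‖ * M) := by field_simp
      _ ≤ 2 * C * (1 + ‖u‖ ^ 2) := by
          gcongr
          nlinarith

/-- Global existence in the cone. The truncated equation `y' = G t (radial M (P y))` has a bounded
and globally Lipschitz right hand side; its solution stays in the cone by quasi-monotonicity and, for
`M` large, in the ball of radius `M` by the growth bound, so that the truncation is not felt. -/
theorem IsConeField.exists_solution [CompleteSpace E] (hK : IsSelfDual K) (hG : IsConeField K G T)
    (hT : 0 ≤ T) {u₀ : E} (hu₀ : u₀ ∈ K) :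
    ∃ y : ℝ → E, y 0 = u₀ ∧ ∀ t ∈ Icc 0 T,
      y t ∈ K ∧ HasDerivWithinAt y (G t (y t)) (Icc 0 T) t := by
  obtain ⟨P, hP⟩ := hK.exists_isConeProj
  obtain ⟨C, hC, hgrow⟩ := hG.growth
  -- Gronwall's bound for solutions of the truncated equations, whatever the radius of truncation.
  set M := Real.sqrt ((1 + ‖u₀‖ ^ 2) * Real.exp (4 * C * T)) with hMdef
  have hM2 : M ^ 2 = (1 + ‖u₀‖ ^ 2) * Real.exp (4 * C * T) := Real.sq_sqrt (by positivity)
  have hM : 1 ≤ M := by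
    rw [hMdef, Real.one_le_sqrt]
    have := Real.one_le_exp (x := 4 * C * T) (by positivity)
    nlinarith [sq_nonneg ‖u₀‖]
  have hM0 : 0 < M := zero_lt_one.trans_le hM
  obtain ⟨L, hL⟩ := hG.lipschitz M
  have hmaps : ∀ u, radial M (P u) ∈ K ∩ Metric.closedBall 0 M := fun u =>
    ⟨hK.smul_mem (by positivity) (hP.mem u), by simpa using norm_radial_le hM0 (P u)⟩
  have h0mem : (0 : E) ∈ K ∩ Metric.closedBall 0 M :=
    ⟨hK.zero_mem, by simpa using hM0.le⟩
  obtain ⟨N, hN⟩ := (isCompact_Icc (a := (0 : ℝ)) (b := T)).exists_bound_of_continuousOn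
    (hG.continuous 0 hK.zero_mem).continuousOn
  have hN0 : 0 ≤ N := (norm_nonneg _).trans (hN 0 ⟨le_rfl, hT⟩)
  set V : ℝ≥0 := ⟨N + L * M, by positivity⟩ with hV
  have hpl : IsPicardLindelof (fun t u => G t (radial M (P u)))
      (⟨0, le_rfl, hT⟩ : Icc 0 T) u₀ (V * ⟨T, hT⟩) 0 V (L * (2 * 1)) := by
    refine ⟨fun t _ => ?_, fun u _ => ?_, fun t ht u _ => ?_, ?_⟩
    · exact ((hL t).comp (((lipschitzWith_radial hM0).comp (hP.lipschitzWith hK)).lipschitzOnWith)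
        fun u _ => hmaps u)
    · exact (hG.continuous _ (hmaps u).1).continuousOn
    · have h1 := (hL t).dist_le_mul _ (hmaps u) _ h0mem
      rw [dist_eq_norm, dist_zero_right] at h1
      have h2 := hN t ht
      have h3 : (L : ℝ) * ‖radial M (P u)‖ ≤ L * M := by
        gcongr
        exact norm_radial_le hM0 _
      have h4 := norm_le_norm_add_norm_sub (G t 0) (G t (radial M (P u)))
      rw [norm_sub_rev] at h4
      change _ ≤ N + L * M
      linarith
    · have : max (T - 0) ((0 : ℝ) - 0) = T := by simp [hT]
      change (V : ℝ) * max (T - 0) ((0 : ℝ) - 0) ≤ V * T - 0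
      rw [this, sub_zero]
  obtain ⟨y, hy0, hy⟩ := hpl.exists_eq_forall_mem_Icc_hasDerivWithinAt₀
  -- `radial M (P y)` is a multiple of `P y`, hence orthogonal to `P y - y` as well.
  have hmem : ∀ t ∈ Icc 0 T, y t ∈ K := by
    refine hP.mem_of_hasDerivWithinAt hK (by simpa [hy0] using hu₀) hy fun t ht => ?_
    rw [real_inner_comm]
    refine hG.quasimonotone t ht _ (hmaps _).1 _ (hP.sub_mem _) ?_
    rw [radial, real_inner_smul_left, hP.orth, mul_zero]
  have hy' : ∀ t ∈ Icc 0 T, HasDerivWithinAt y (G t (radial M (y t))) (Icc 0 T) t := fun t ht => by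
    have := hy t ht
    simpa only [(hP.apply_eq_iff hK _).2 (hmem t ht)] using this
  have hle : ∀ t ∈ Icc 0 T, ‖y t‖ ≤ M := by
    have hder : ∀ t ∈ Icc 0 T, HasDerivWithinAt
        (fun t => (1 + ‖y t‖ ^ 2) * Real.exp (-(4 * C * t)))
        ((2 * ⟪y t, G t (radial M (y t))⟫_ℝ) * Real.exp (-(4 * C * t)) +
          (1 + ‖y t‖ ^ 2) * (Real.exp (-(4 * C * t)) * (-(4 * C * 1)))) (Icc 0 T) t := fun t ht =>
      (((hy' t ht).norm_sq).const_add 1).mul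
        ((((hasDerivAt_id t).const_mul (4 * C)).neg.exp).hasDerivWithinAt)
    have hanti : AntitoneOn (fun t => (1 + ‖y t‖ ^ 2) * Real.exp (-(4 * C * t))) (Icc 0 T) := by
      refine antitoneOn_of_hasDerivWithinAt_nonpos (convex_Icc 0 T)
        (fun t ht => (hder t ht).continuousWithinAt)
        (fun t ht => (hder t (interior_subset ht)).mono interior_subset) fun t ht => ?_
      have ht' := interior_subset ht
      have h1 := inner_radial_le hC hM (hgrow t ht' (radial M (y t))
        (hK.smul_mem (by positivity) (hmem t ht')))
      rw [real_inner_comm] at h1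
      have h2 := Real.exp_pos (-(4 * C * t))
      have h3 : (2 * ⟪y t, G t (radial M (y t))⟫_ℝ) * Real.exp (-(4 * C * t)) +
          (1 + ‖y t‖ ^ 2) * (Real.exp (-(4 * C * t)) * (-(4 * C * 1)))
          = Real.exp (-(4 * C * t)) *
            (2 * (⟪y t, G t (radial M (y t))⟫_ℝ - 2 * C * (1 + ‖y t‖ ^ 2))) := by ring
      rw [h3]
      exact mul_nonpos_of_nonneg_of_nonpos h2.le (by linarith)
    intro t ht
    have h1 := hanti ⟨le_rfl, hT⟩ ht ht.1
    have hy0' : y 0 = u₀ := hy0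
    simp only [hy0', mul_zero, neg_zero, Real.exp_zero, mul_one] at h1
    rw [Real.exp_neg, ← div_eq_mul_inv, div_le_iff₀ (Real.exp_pos _)] at h1
    have h2 : Real.exp (4 * C * t) ≤ Real.exp (4 * C * T) := by
      have := ht.2
      gcongr
    have h3 : (1 + ‖u₀‖ ^ 2) * Real.exp (4 * C * t) ≤ M ^ 2 := by
      rw [hM2]
      gcongr
    exact le_of_sq_le_sq (by linarith) hM0.le
  refine ⟨y, hy0, fun t ht => ⟨hmem t ht, ?_⟩⟩
  have := hy' t ht
  rwa [radial_of_norm_le hM0 (hle t ht)] at this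

/-- On bounded time intervals a cone field is jointly continuous along continuous curves in the
cone. -/
theorem IsConeField.continuousOn_comp (hG : IsConeField K G T) {y : ℝ → E}
    (hy : ContinuousOn y (Icc 0 T)) (hmem : ∀ t ∈ Icc 0 T, y t ∈ K) :
    ContinuousOn (fun t => G t (y t)) (Icc 0 T) := by
  obtain ⟨M, hM⟩ := (isCompact_Icc (a := (0 : ℝ)) (b := T)).exists_bound_of_continuousOn hy
  obtain ⟨L, hL⟩ := hG.lipschitz M
  have h : ContinuousOn (Function.uncurry G) (univ ×ˢ (K ∩ Metric.closedBall 0 M)) :=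
    continuousOn_prod_of_continuousOn_lipschitzOnWith' _ L (fun t _ => hL t)
      fun u hu => (hG.continuous u hu.1).continuousOn
  exact h.comp (continuousOn_id.prodMk hy)
    fun t ht => ⟨mem_univ _, hmem t ht, by simpa using hM t ht⟩

theorem IsConeField.eqOn_of_solution (hG : IsConeField K G T) {y z : ℝ → E}
    (hy : ∀ t ∈ Icc 0 T, y t ∈ K ∧ HasDerivWithinAt y (G t (y t)) (Icc 0 T) t)
    (hz : ∀ t ∈ Icc 0 T, z t ∈ K ∧ HasDerivWithinAt z (G t (z t)) (Icc 0 T) t)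
    (h0 : y 0 = z 0) : EqOn y z (Icc 0 T) := by
  have hyc : ContinuousOn y (Icc 0 T) := fun t ht => (hy t ht).2.continuousWithinAt
  have hzc : ContinuousOn z (Icc 0 T) := fun t ht => (hz t ht).2.continuousWithinAt
  obtain ⟨M, hM⟩ := (isCompact_Icc (a := (0 : ℝ)) (b := T)).exists_bound_of_continuousOn hyc
  obtain ⟨N, hN⟩ := (isCompact_Icc (a := (0 : ℝ)) (b := T)).exists_bound_of_continuousOn hzc
  obtain ⟨L, hL⟩ := hG.lipschitz (max M N)
  have hIci : ∀ {w : ℝ → E} {d : E} {t : ℝ}, t ∈ Ico 0 T → HasDerivWithinAt w d (Icc 0 T) t →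
      HasDerivWithinAt w d (Ici t) t := fun ht h =>
    h.mono_of_mem_nhdsWithin
      (mem_of_superset (Icc_mem_nhdsGE ht.2) (Icc_subset_Icc_left ht.1))
  refine ODE_solution_unique_of_mem_Icc_right (K := L) (v := G)
    (s := fun _ => K ∩ Metric.closedBall 0 (max M N)) (fun t _ => hL t) hyc
    (fun t ht => hIci ht (hy t (Ico_subset_Icc_self ht)).2) (fun t ht => ?_) hzc
    (fun t ht => hIci ht (hz t (Ico_subset_Icc_self ht)).2) (fun t ht => ?_) h0
  · have ht' := Ico_subset_Icc_self ht
    exact ⟨(hy t ht').1, by simpa using .inl (hM t ht')⟩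
  · have ht' := Ico_subset_Icc_self ht
    exact ⟨(hz t ht').1, by simpa using .inr (hN t ht')⟩

end ODE

/-! ### The cone of positive Hilbert-Schmidt operators -/

section PosCone

variable {H : Type*} [NormedAddCommGroup H] [InnerProductSpace ℝ H] [CompleteSpace H]

namespace SHS

theorem inner_op_left (A : SHS H) (x y : H) : ⟪A.op x, y⟫_ℝ = ⟪x, A.op y⟫_ℝ := by
  rw [← ContinuousLinearMap.adjoint_inner_right, A.isSelfAdjoint.adjoint_eq]

/-- The Hilbert-Schmidt inner product with a rank one operator. -/
theorem inner_tensorSq (A : SHS H) (a : H) : ⟪A, tensorSq a⟫_ℝ = ⟪A.op a, a⟫_ℝ := by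
  rw [inner_def, ← (onb H).tsum_inner_mul_inner (A.op a) a]
  refine tsum_congr fun i => ?_
  rw [tensorSq_op_apply, real_inner_smul_right, inner_op_left A a,
    real_inner_comm a (A.op (onb H i)), real_inner_comm a (onb H i)]
  ring

end SHS

theorem tensorSq_mem_posCone (a : H) : tensorSq a ∈ posCone H := fun h => by
  rw [tensorSq_op_apply, real_inner_smul_left]
  exact mul_self_nonneg _

theorem tensorSq_zero : tensorSq (0 : H) = 0 := by
  apply SHS.op_injective
  ext h
  simp [tensorSq_op_apply]

theorem continuous_tensorSq : Continuous (tensorSq : H → SHS H) := by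
  rw [continuous_iff_continuousAt]
  intro c
  rw [ContinuousAt, tendsto_iff_norm_sub_tendsto_zero]
  have hin : ∀ a c : H, ⟪tensorSq a, tensorSq c⟫_ℝ = ⟪a, c⟫_ℝ ^ 2 := fun a c => by
    rw [SHS.inner_tensorSq, tensorSq_op_apply, real_inner_smul_left, sq]
  have h : ∀ a : H, ‖tensorSq a - tensorSq c‖
      = √(⟪a, a⟫_ℝ ^ 2 - 2 * ⟪a, c⟫_ℝ ^ 2 + ⟪c, c⟫_ℝ ^ 2) := fun a => by
    rw [← hin, ← hin, ← hin, real_inner_self_eq_norm_sq, real_inner_self_eq_norm_sq,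
      ← norm_sub_sq_real, Real.sqrt_sq (norm_nonneg _)]
  simp_rw [h]
  have hc : Continuous fun a : H => √(⟪a, a⟫_ℝ ^ 2 - 2 * ⟪a, c⟫_ℝ ^ 2 + ⟪c, c⟫_ℝ ^ 2) := by
    fun_prop
  have := hc.tendsto c
  rwa [show ⟪c, c⟫_ℝ ^ 2 - 2 * ⟪c, c⟫_ℝ ^ 2 + ⟪c, c⟫_ℝ ^ 2 = 0 by ring, Real.sqrt_zero] at this

/-- The matrix of a positive operator with respect to finitely many vectors of the basis is positive
semidefinite. -/
theorem posSemidef_of_mem_posCone {A : SHS H} (hA : A ∈ posCone H) (F : Finset (BasisIndex H)) :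
    (Matrix.of fun i j : F => ⟪A.op (onb H i), onb H j⟫_ℝ).PosSemidef := by
  refine Matrix.PosSemidef.of_dotProduct_mulVec_nonneg ?_ fun c => ?_
  · ext i j
    simp only [Matrix.conjTranspose_apply, Matrix.of_apply, star_trivial]
    rw [SHS.inner_op_left A (onb H j), real_inner_comm]
  · have h : star c ⬝ᵥ (Matrix.of fun i j : F => ⟪A.op (onb H i), onb H j⟫_ℝ).mulVec c
        = ⟪A.op (∑ i, c i • onb H i), ∑ j, c j • onb H j⟫_ℝ := by
      simp only [dotProduct, Matrix.mulVec, map_sum, map_smul, sum_inner, inner_sum,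
        real_inner_smul_left, real_inner_smul_right, Matrix.of_apply, Pi.star_apply, star_trivial,
        Finset.mul_sum]
      rw [Finset.sum_comm]
      refine Finset.sum_congr rfl fun i _ => ?_
      refine Finset.sum_congr rfl fun j _ => ?_
      ring
    rw [h]
    exact hA _

/-- By the Schur product theorem all finite sections of the double series
`⟪A, C⟫ = ∑ᵢⱼ ⟪A eᵢ, eⱼ⟫ ⟪C eᵢ, eⱼ⟫` are nonnegative. -/
theorem inner_nonneg_of_mem_posCone {A C : SHS H} (hA : A ∈ posCone H) (hC : C ∈ posCone H) :
    0 ≤ ⟪A, C⟫_ℝ := by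
  set f : BasisIndex H × BasisIndex H → ℝ := fun p =>
    ⟪A.op (onb H p.1), onb H p.2⟫_ℝ * ⟪C.op (onb H p.1), onb H p.2⟫_ℝ with hf
  have hsq : ∀ A : SHS H, Summable fun p : BasisIndex H × BasisIndex H =>
      ⟪A.op (onb H p.1), onb H p.2⟫_ℝ ^ 2 := fun A => by
    have hrow : ∀ i, HasSum (fun j => ⟪A.op (onb H i), onb H j⟫_ℝ ^ 2)
        (‖A.op (onb H i)‖ ^ 2) := fun i => by
      rw [← real_inner_self_eq_norm_sq]
      refine ((onb H).hasSum_inner_mul_inner (A.op (onb H i)) (A.op (onb H i))).congr_fun ?_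
      intro j
      rw [real_inner_comm (A.op (onb H i)) (onb H j), sq]
    refine (summable_prod_of_nonneg fun p => sq_nonneg _).2 ⟨fun i => (hrow i).summable, ?_⟩
    refine A.summable_sq.congr fun i => ?_
    exact (hrow i).tsum_eq.symm
  have hsum : Summable f := by
    refine Summable.of_norm_bounded ((hsq A).add (hsq C)) fun p => ?_
    rw [hf, Real.norm_eq_abs, abs_mul]
    have h1 := sq_abs ⟪A.op (onb H p.1), onb H p.2⟫_ℝ
    have h2 := sq_abs ⟪C.op (onb H p.1), onb H p.2⟫_ℝ
    nlinarith [sq_nonneg (|⟪A.op (onb H p.1), onb H p.2⟫_ℝ| - |⟪C.op (onb H p.1), onb H p.2⟫_ℝ|),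
      sq_nonneg ⟪A.op (onb H p.1), onb H p.2⟫_ℝ, sq_nonneg ⟪C.op (onb H p.1), onb H p.2⟫_ℝ]
  have htot : ⟪A, C⟫_ℝ = ∑' p, f p := by
    rw [hsum.tsum_prod, SHS.inner_def]
    refine tsum_congr fun i => ?_
    rw [← (onb H).tsum_inner_mul_inner]
    refine tsum_congr fun j => ?_
    rw [hf, real_inner_comm (C.op (onb H i)) (onb H j)]
  rw [htot]
  have hlim : Tendsto (fun F : Finset (BasisIndex H) => ∑ p ∈ F ×ˢ F, f p) atTop
      (𝓝 (∑' p, f p)) :=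
    hsum.hasSum.comp (Filter.tendsto_finsetProd_atTop.comp
      (tendsto_id.prodMk tendsto_id |>.trans (prod_atTop_atTop_eq).le))
  refine ge_of_tendsto' hlim fun F => ?_
  have hpsd := (posSemidef_of_mem_posCone hA F).hadamard (posSemidef_of_mem_posCone hC F)
  have := hpsd.dotProduct_mulVec_nonneg fun _ => (1 : ℝ)
  simp only [dotProduct, Matrix.mulVec, Matrix.hadamard_apply, Matrix.of_apply, Pi.star_apply,
    star_trivial, one_mul, mul_one] at this
  rw [Finset.sum_product, ← Finset.sum_coe_sort F]
  refine this.trans_eq (Finset.sum_congr rfl fun i _ => ?_)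
  exact Finset.sum_coe_sort F fun j => f (i, j)

variable (H) in
theorem isSelfDual_posCone : IsSelfDual (posCone H) := fun A =>
  ⟨fun hA _ hC => inner_nonneg_of_mem_posCone hA hC, fun h a => by
    rw [← SHS.inner_tensorSq]
    exact h _ (tensorSq_mem_posCone a)⟩

end PosCone

/-! ### The integrand of the generalised Riccati equations -/

section Kernel

/-- The function `a ↦ exp (-a) - 1 + a` has Lipschitz constant `M` on `[0, M]`. -/
theorem abs_exp_neg_sub_one_add_sub_le {a b M : ℝ} (ha : 0 ≤ a) (hb : 0 ≤ b) (haM : a ≤ M)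
    (hbM : b ≤ M) :
    |(Real.exp (-a) - 1 + a) - (Real.exp (-b) - 1 + b)| ≤ M * |a - b| := by
  wlog hab : a ≤ b generalizing a b
  · have := this hb ha hbM haM (le_of_not_ge hab)
    rwa [abs_sub_comm, abs_sub_comm a b]
  have h1 : Real.exp (-b) = Real.exp (-a) * Real.exp (-(b - a)) := by
    rw [← Real.exp_add]
    ring_nf
  have h2 := Real.add_one_le_exp (-(b - a))
  have h3 : Real.exp (-(b - a)) ≤ 1 := Real.exp_le_one_iff.2 (by linarith)
  have h4 : Real.exp (-a) ≤ 1 := Real.exp_le_one_iff.2 (by linarith)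
  have h5 := Real.add_one_le_exp (-b)
  have h6 := Real.exp_pos (-a)
  have h7 := Real.add_one_le_exp (b - a)
  have h8 : Real.exp (-a) = Real.exp (-b) * Real.exp (b - a) := by
    rw [← Real.exp_add]
    ring_nf
  have h9 := Real.exp_pos (-b)
  rw [abs_sub_comm a b, abs_of_nonneg (sub_nonneg.2 hab), abs_le]
  constructor
  · have : Real.exp (-b) * (b - a) ≤ Real.exp (-a) - Real.exp (-b) := by
      rw [h8]
      nlinarith
    nlinarith
  · have : Real.exp (-a) - Real.exp (-b) ≤ b - a := by
      rw [h1]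
      nlinarith
    nlinarith [mul_nonneg (ha.trans haM) (sub_nonneg.2 hab)]

theorem abs_exp_neg_sub_exp_neg_le {a b : ℝ} (ha : 0 ≤ a) (hb : 0 ≤ b) :
    |Real.exp (-a) - Real.exp (-b)| ≤ |a - b| := by
  wlog hab : a ≤ b generalizing a b
  · have := this hb ha (le_of_not_ge hab)
    rwa [abs_sub_comm, abs_sub_comm a b]
  have h1 : Real.exp (-b) = Real.exp (-a) * Real.exp (-(b - a)) := by
    rw [← Real.exp_add]
    ring_nf
  have h2 := Real.add_one_le_exp (-(b - a))
  have h3 : Real.exp (-(b - a)) ≤ 1 := Real.exp_le_one_iff.2 (by linarith)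
  have h4 : Real.exp (-a) ≤ 1 := Real.exp_le_one_iff.2 (by linarith)
  have h6 := Real.exp_pos (-a)
  rw [abs_sub_comm a b, abs_of_nonneg (sub_nonneg.2 hab), h1, abs_of_nonneg (by nlinarith)]
  nlinarith

variable {H : Type*} [NormedAddCommGroup H] [InnerProductSpace ℝ H] [CompleteSpace H]

/-- The integrand `exp(-⟨ξ, u⟩) - 1 + ⟨χ(ξ), u⟩` of the generalised Riccati equations. -/
noncomputable def kernel (u ξ : SHS H) : ℝ := Real.exp (-⟪ξ, u⟫_ℝ) - 1 + ⟪chi ξ, u⟫_ℝ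

theorem chi_of_norm_le {ξ : SHS H} (h : ‖ξ‖ ≤ 1) : chi ξ = ξ := if_pos h

theorem chi_of_one_lt_norm {ξ : SHS H} (h : 1 < ‖ξ‖) : chi ξ = 0 := if_neg h.not_ge

theorem measurable_chi : Measurable (chi : SHS H → SHS H) := by
  refine Measurable.ite ?_ measurable_id measurable_const
  exact (isClosed_le continuous_norm continuous_const).measurableSet

theorem measurable_inner_chi (u : SHS H) : Measurable fun ξ : Jump H => ⟪chi ξ.1, u⟫_ℝ :=
  (Continuous.measurable (f := fun x : SHS H => ⟪x, u⟫_ℝ) (by fun_prop)).comp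
    (measurable_chi.comp measurable_subtype_coe)

theorem measurable_exp_inner (u : SHS H) : Measurable fun ξ : Jump H => Real.exp (-⟪ξ.1, u⟫_ℝ) :=
  (Continuous.measurable (f := fun x : SHS H => Real.exp (-⟪x, u⟫_ℝ)) (by fun_prop)).comp
    measurable_subtype_coe

theorem measurable_norm_sq : Measurable fun ξ : Jump H => ‖ξ.1‖ ^ 2 :=
  (Continuous.measurable (f := fun x : SHS H => ‖x‖ ^ 2) (by fun_prop)).comp
    measurable_subtype_coe

theorem measurable_kernel (u : SHS H) : Measurable fun ξ : Jump H => kernel u ξ.1 :=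
  ((measurable_exp_inner u).sub_const 1).add (measurable_inner_chi u)

theorem kernel_zero (ξ : SHS H) : kernel 0 ξ = 0 := by simp [kernel]

/-- The kernel is Lipschitz on bounded subsets of the cone, with a constant of the order of `‖ξ‖²`:
for small `ξ` the linear terms cancel, for large `ξ` one uses `‖ξ‖ ≤ ‖ξ‖²`. -/
theorem abs_kernel_sub_le {u v ξ : SHS H} {M : ℝ} (hM : 1 ≤ M) (hξ : ξ ∈ posCone H)
    (hu : u ∈ posCone H) (hv : v ∈ posCone H) (huM : ‖u‖ ≤ M) (hvM : ‖v‖ ≤ M) :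
    |kernel u ξ - kernel v ξ| ≤ M * ‖u - v‖ * ‖ξ‖ ^ 2 := by
  have ha := inner_nonneg_of_mem_posCone hξ hu
  have hb := inner_nonneg_of_mem_posCone hξ hv
  have hab : |⟪ξ, u⟫_ℝ - ⟪ξ, v⟫_ℝ| ≤ ‖ξ‖ * ‖u - v‖ := by
    rw [← inner_sub_right]
    exact abs_real_inner_le_norm _ _
  have hn := norm_nonneg ξ
  have hn' := norm_nonneg (u - v)
  rcases le_or_gt ‖ξ‖ 1 with h1 | h1
  · rw [kernel, kernel, chi_of_norm_le h1]
    have ha' : ⟪ξ, u⟫_ℝ ≤ M * ‖ξ‖ := (real_inner_le_norm _ _).trans (by nlinarith)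
    have hb' : ⟪ξ, v⟫_ℝ ≤ M * ‖ξ‖ := (real_inner_le_norm _ _).trans (by nlinarith)
    calc _ ≤ M * ‖ξ‖ * |⟪ξ, u⟫_ℝ - ⟪ξ, v⟫_ℝ| :=
          abs_exp_neg_sub_one_add_sub_le ha hb ha' hb'
      _ ≤ M * ‖ξ‖ * (‖ξ‖ * ‖u - v‖) := by gcongr
      _ = M * ‖u - v‖ * ‖ξ‖ ^ 2 := by ring
  · rw [kernel, kernel, chi_of_one_lt_norm h1]
    simp only [inner_zero_left, add_zero, sub_sub_sub_cancel_right]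
    calc _ ≤ |⟪ξ, u⟫_ℝ - ⟪ξ, v⟫_ℝ| := abs_exp_neg_sub_exp_neg_le ha hb
      _ ≤ ‖ξ‖ * ‖u - v‖ := hab
      _ = 1 * ‖u - v‖ * (‖ξ‖ * 1) := by ring
      _ ≤ M * ‖u - v‖ * (‖ξ‖ * ‖ξ‖) := by gcongr
      _ = M * ‖u - v‖ * ‖ξ‖ ^ 2 := by ring

theorem abs_kernel_le {u ξ : SHS H} {M : ℝ} (hM : 1 ≤ M) (hξ : ξ ∈ posCone H)
    (hu : u ∈ posCone H) (huM : ‖u‖ ≤ M) : |kernel u ξ| ≤ M ^ 2 * ‖ξ‖ ^ 2 := by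
  have h := abs_kernel_sub_le hM hξ hu (isSelfDual_posCone H).zero_mem huM
    (by simpa using zero_le_one.trans hM)
  rw [kernel_zero, sub_zero, sub_zero] at h
  refine h.trans ?_
  rw [sq M]
  gcongr

/-- The kernel is nonnegative for small `ξ`, and at least `-1` for large `ξ`. -/
theorem neg_norm_sq_le_kernel {u ξ : SHS H} : -‖ξ‖ ^ 2 ≤ kernel u ξ := by
  rcases le_or_gt ‖ξ‖ 1 with h1 | h1
  · rw [kernel, chi_of_norm_le h1]
    have := Real.add_one_le_exp (-⟪ξ, u⟫_ℝ)
    nlinarith [sq_nonneg ‖ξ‖]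
  · rw [kernel, chi_of_one_lt_norm h1, inner_zero_left]
    have := Real.exp_pos (-⟪ξ, u⟫_ℝ)
    nlinarith

theorem kernel_le_inner_chi {u ξ : SHS H} (hξ : ξ ∈ posCone H) (hu : u ∈ posCone H) :
    kernel u ξ ≤ ⟪chi ξ, u⟫_ℝ := by
  have : Real.exp (-⟪ξ, u⟫_ℝ) ≤ 1 :=
    Real.exp_le_one_iff.2 (neg_nonpos.2 (inner_nonneg_of_mem_posCone hξ hu))
  rw [kernel]
  linarith

end Kernel

/-! ### The right hand side of the equation for `Φ` -/

section RiccatiF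

variable {H : Type*} [NormedAddCommGroup H] [InnerProductSpace ℝ H] [CompleteSpace H]
variable {b : SHS H} {B : SHS H →L[ℝ] SHS H} {m : Measure (Jump H)}
  {μ : VectorMeasure (Jump H) (SHS H)}

theorem IsAdmissible.integrable_kernel (h : IsAdmissible b B m μ) {u : SHS H}
    (hu : u ∈ posCone H) : Integrable (fun ξ : Jump H => kernel u ξ.1) m := by
  refine (h.m_sq.const_mul (max 1 ‖u‖ ^ 2)).mono' (measurable_kernel u).aestronglyMeasurable
    (Eventually.of_forall fun ξ => ?_)
  exact abs_kernel_le (le_max_left _ _) ξ.2.1 hu (le_max_right _ _)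

theorem IsAdmissible.riccatiF_nonneg (h : IsAdmissible b B m μ) {u : SHS H}
    (hu : u ∈ posCone H) : 0 ≤ riccatiF b m u := by
  have h1 : ∫ ξ : Jump H, kernel u ξ.1 ∂m ≤ ∫ ξ : Jump H, ⟪chi ξ.1, u⟫_ℝ ∂m :=
    integral_mono (h.integrable_kernel hu) (h.m_chi u) fun ξ => kernel_le_inner_chi ξ.2.1 hu
  exact (h.b_ge u hu).trans (sub_le_sub_left h1 _)

theorem IsAdmissible.continuousOn_riccatiF (h : IsAdmissible b B m μ) :
    ContinuousOn (riccatiF b m) (posCone H) := by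
  refine ContinuousOn.sub (by fun_prop) fun u hu => ?_
  refine continuousWithinAt_of_dominated (F := fun u (ξ : Jump H) => kernel u ξ.1)
    (bound := fun ξ : Jump H => (‖u‖ + 1) ^ 2 * ‖ξ.1‖ ^ 2)
    (Eventually.of_forall fun v => (measurable_kernel v).aestronglyMeasurable) ?_
    (h.m_sq.const_mul _) (Eventually.of_forall fun ξ => ?_)
  · have hev : ∀ᶠ v in 𝓝[posCone H] u, ‖v‖ < ‖u‖ + 1 :=
      (continuous_norm.continuousWithinAt).eventually_lt continuousWithinAt_const (by simp)
    filter_upwards [hev, self_mem_nhdsWithin] with v hv hvK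
    exact Eventually.of_forall fun ξ =>
      abs_kernel_le (by linarith [norm_nonneg u]) ξ.2.1 hvK hv.le
  · refine Continuous.continuousWithinAt ?_
    unfold kernel
    fun_prop

end RiccatiF

/-! ### Integrals against the cone-valued jump measure -/

section Pairing

variable {H : Type*} [NormedAddCommGroup H] [InnerProductSpace ℝ H] [CompleteSpace H]
variable {μ : VectorMeasure (Jump H) (SHS H)}

/-- The variation of `⟨μ(dξ), x⟩` is bounded by the semivariation of `μ`, although `μ` need not have
finite variation. -/
theorem variation_pairing_le (μ : VectorMeasure (Jump H) (SHS H)) (x : SHS H) :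
    (pairing μ x).variation univ ≤ ENNReal.ofReal (2 * μ.bound * ‖x‖) := by
  by_contra! hlt
  obtain ⟨t, -, -, ht⟩ :=
    SignedMeasure.exists_subset_lt_enorm_apply_of_lt_variation _ MeasurableSet.univ hlt
  refine ht.not_ge ?_
  have h1 : ‖pairing μ x t‖ ≤ μ.bound * ‖x‖ := by
    rw [pairing_apply]
    exact (norm_inner_le_norm _ _).trans (by gcongr; exact VectorMeasure.norm_apply_le_bound)
  rw [mul_assoc, ENNReal.ofReal_mul zero_le_two, ← ofReal_norm]
  simp only [ENNReal.ofReal_ofNat]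
  gcongr

instance (x : SHS H) : IsFiniteMeasure (pairing μ x).variation :=
  ⟨(variation_pairing_le μ x).trans_lt ENNReal.ofReal_lt_top⟩

theorem abs_integral_pairing_le (x : SHS H) {f : Jump H → ℝ} {C : ℝ} (hC : 0 ≤ C)
    (hf : ∀ ξ, |f ξ| ≤ C) :
    |(pairing μ x).integral f (ContinuousLinearMap.lsmul ℝ ℝ)| ≤ C * (2 * μ.bound * ‖x‖) := by
  have h1 := VectorMeasure.norm_integral_le_of_norm_le_const (μ := pairing μ x)
    (B := ContinuousLinearMap.lsmul ℝ ℝ) (f := f) (C := C) (Eventually.of_forall hf)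
  refine h1.trans ?_
  have h2 : ‖(ContinuousLinearMap.lsmul ℝ ℝ : ℝ →L[ℝ] ℝ →L[ℝ] ℝ)‖ ≤ 1 :=
    ContinuousLinearMap.opNorm_lsmul_le
  have h3 : (pairing μ x).variation.real univ ≤ 2 * μ.bound * ‖x‖ :=
    ENNReal.toReal_le_of_le_ofReal (by positivity) (variation_pairing_le μ x)
  calc C * ‖(ContinuousLinearMap.lsmul ℝ ℝ : ℝ →L[ℝ] ℝ →L[ℝ] ℝ)‖ *
        (pairing μ x).variation.real univ ≤ C * 1 * (2 * μ.bound * ‖x‖) := by gcongr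
    _ = _ := by ring

theorem integral_pairing_nonneg (hμ : ∀ s, μ s ∈ posCone H) {x : SHS H} (hx : x ∈ posCone H)
    {f : Jump H → ℝ} (hf : ∀ ξ, 0 ≤ f ξ) :
    0 ≤ (pairing μ x).integral f (ContinuousLinearMap.lsmul ℝ ℝ) := by
  have h0 : 0 ≤[univ] pairing μ x := by
    refine (VectorMeasure.restrict_le_restrict_iff _ _ MeasurableSet.univ).2 fun s _ _ => ?_
    rw [pairing_apply]
    exact inner_nonneg_of_mem_posCone (hμ s) hx
  have hB : (ContinuousLinearMap.lsmul ℝ ℝ : ℝ →L[ℝ] ℝ →L[ℝ] ℝ) =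
      (ContinuousLinearMap.lsmul ℝ ℝ : ℝ →L[ℝ] ℝ →L[ℝ] ℝ).flip := by
    ext
    simp
  rw [← SignedMeasure.toMeasureOfZeroLE_toSignedMeasure _ h0, hB,
    VectorMeasure.integral_toSignedMeasure]
  exact integral_nonneg hf

theorem integrable_pairing_of_bounded (x : SHS H) {f : Jump H → ℝ} (hm : Measurable f) {C : ℝ}
    (hf : ∀ ξ, |f ξ| ≤ C) : (pairing μ x).Integrable f :=
  Integrable.of_bound hm.aestronglyMeasurable C (Eventually.of_forall hf)

end Pairing

/-! ### The right hand side of the equation for `ψ₂` -/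

section RiccatiR

variable {H : Type*} [NormedAddCommGroup H] [InnerProductSpace ℝ H] [CompleteSpace H]
variable {b : SHS H} {B : SHS H →L[ℝ] SHS H} {m : Measure (Jump H)}
  {μ : VectorMeasure (Jump H) (SHS H)}

/-- The `ℋ`-valued integral in `R(h, u)`. -/
noncomputable def jumpIntegral (μ : VectorMeasure (Jump H) (SHS H)) (u : SHS H) : SHS H :=
  weakIntegral μ fun ξ => kernel u ξ.1 / ‖ξ.1‖ ^ 2

theorem riccatiR_eq (D : H →L[ℝ] H) {h : Cplx H} (hh : h ∈ imag H) (u : SHS H) :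
    riccatiR B D μ h u = ContinuousLinearMap.adjoint B u + (1 / 2 : ℝ) • tensorSq (sqrtOp D h.2) -
      jumpIntegral μ u := by
  have h1 : h.1 = 0 := hh
  rw [riccatiR, tensorSqC, extend, h1, map_zero, tensorSq_zero, zero_sub, smul_neg, sub_neg_eq_add]
  rfl

theorem norm_sq_pos (ξ : Jump H) : 0 < ‖ξ.1‖ ^ 2 := by
  have := norm_pos_iff.2 ξ.2.2
  positivity

theorem measurable_kernel_div (u : SHS H) :
    Measurable fun ξ : Jump H => kernel u ξ.1 / ‖ξ.1‖ ^ 2 :=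
  (measurable_kernel u).div measurable_norm_sq

theorem abs_kernel_div_le {u : SHS H} (hu : u ∈ posCone H) (ξ : Jump H) :
    |kernel u ξ.1 / ‖ξ.1‖ ^ 2| ≤ max 1 ‖u‖ ^ 2 := by
  rw [abs_div, abs_of_pos (norm_sq_pos ξ), div_le_iff₀ (norm_sq_pos ξ)]
  exact abs_kernel_le (le_max_left _ _) ξ.2.1 hu (le_max_right _ _)

theorem integrable_kernel_div {u : SHS H} (hu : u ∈ posCone H) (x : SHS H) :
    (pairing μ x).Integrable fun ξ => kernel u ξ.1 / ‖ξ.1‖ ^ 2 :=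
  integrable_pairing_of_bounded x (measurable_kernel_div u) (abs_kernel_div_le hu)

theorem inner_jumpIntegral {u : SHS H} (hu : u ∈ posCone H) (x : SHS H) :
    ⟪jumpIntegral μ u, x⟫_ℝ = (pairing μ x).integral (fun ξ => kernel u ξ.1 / ‖ξ.1‖ ^ 2)
      (ContinuousLinearMap.lsmul ℝ ℝ) := by
  obtain ⟨I, hI⟩ := exists_hasWeakIntegral (μ := μ) (measurable_kernel_div u)
    (integrable_kernel_div hu)
  rw [jumpIntegral, hI.weakIntegral_eq]
  exact (hI x).2

theorem norm_jumpIntegral_sub_le {u v : SHS H} {M : ℝ} (hM : 1 ≤ M) (hu : u ∈ posCone H)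
    (hv : v ∈ posCone H) (huM : ‖u‖ ≤ M) (hvM : ‖v‖ ≤ M) :
    ‖jumpIntegral μ u - jumpIntegral μ v‖ ≤ M * (2 * μ.bound) * ‖u - v‖ := by
  set w := jumpIntegral μ u - jumpIntegral μ v with hw
  have h1 : ‖w‖ ^ 2 ≤ M * ‖u - v‖ * (2 * μ.bound * ‖w‖) := by
    have h2 : ‖w‖ ^ 2 = (pairing μ w).integral
        (fun ξ => kernel u ξ.1 / ‖ξ.1‖ ^ 2 - kernel v ξ.1 / ‖ξ.1‖ ^ 2)
        (ContinuousLinearMap.lsmul ℝ ℝ) := by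
      rw [VectorMeasure.integral_fun_sub (integrable_kernel_div hu w) (integrable_kernel_div hv w),
        ← inner_jumpIntegral hu, ← inner_jumpIntegral hv, ← inner_sub_left, ← hw,
        real_inner_self_eq_norm_sq]
    rw [h2]
    refine (le_abs_self _).trans (abs_integral_pairing_le w (by positivity) fun ξ => ?_)
    rw [← sub_div, abs_div, abs_of_pos (norm_sq_pos ξ), div_le_iff₀ (norm_sq_pos ξ)]
    exact abs_kernel_sub_le hM ξ.2.1 hu hv huM hvM
  rcases (norm_nonneg w).eq_or_lt with h0 | h0
  · rw [← h0]
    positivity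
  · refine le_of_mul_le_mul_right ?_ h0
    linarith

theorem neg_inner_jumpIntegral_le (hμ : ∀ s, μ s ∈ posCone H) {u x : SHS H} (hu : u ∈ posCone H)
    (hx : x ∈ posCone H) : -⟪jumpIntegral μ u, x⟫_ℝ ≤ 2 * μ.bound * ‖x‖ := by
  have h1 := integral_pairing_nonneg hμ hx
    (f := fun ξ => kernel u ξ.1 / ‖ξ.1‖ ^ 2 + 1) fun ξ => by
      have := neg_norm_sq_le_kernel (u := u) (ξ := ξ.1)
      rw [← neg_le_iff_add_nonneg, le_div_iff₀ (norm_sq_pos ξ)]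
      linarith
  have h2 := abs_integral_pairing_le (μ := μ) x (f := fun _ => 1) zero_le_one
    fun ξ => (abs_one).le
  rw [VectorMeasure.integral_fun_add (integrable_kernel_div hu x)
    (integrable_pairing_of_bounded x measurable_const fun ξ => (abs_one).le),
    ← inner_jumpIntegral hu] at h1
  linarith [le_abs_self ((pairing μ x).integral (fun _ => 1) (ContinuousLinearMap.lsmul ℝ ℝ))]

theorem IsAdmissible.inner_jumpIntegral_le (h : IsAdmissible b B m μ) {u x : SHS H}
    (hu : u ∈ posCone H) (hx : x ∈ posCone H) (hux : ⟪u, x⟫_ℝ = 0) :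
    ⟪jumpIntegral μ u, x⟫_ℝ ≤ ⟪ContinuousLinearMap.adjoint B u, x⟫_ℝ := by
  have h1 := integral_pairing_nonneg h.mu_mem hx
    (f := fun ξ => ⟪chi ξ.1, u⟫_ℝ / ‖ξ.1‖ ^ 2 - kernel u ξ.1 / ‖ξ.1‖ ^ 2) fun ξ => by
      rw [← sub_div]
      exact div_nonneg (sub_nonneg.2 (kernel_le_inner_chi ξ.2.1 hu)) (sq_nonneg _)
  rw [VectorMeasure.integral_fun_sub (h.mu_chi u hu x hx hux) (integrable_kernel_div hu x),
    ← inner_jumpIntegral hu] at h1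
  linarith [h.B_ge u hu x hx hux]

theorem norm_riccatiR_sub_le (D : H →L[ℝ] H) {h : Cplx H} (hh : h ∈ imag H) {u v : SHS H} {M : ℝ}
    (hM : 1 ≤ M) (hu : u ∈ posCone H) (hv : v ∈ posCone H) (huM : ‖u‖ ≤ M) (hvM : ‖v‖ ≤ M) :
    ‖riccatiR B D μ h u - riccatiR B D μ h v‖
      ≤ (‖ContinuousLinearMap.adjoint B‖ + M * (2 * μ.bound)) * ‖u - v‖ := by
  rw [riccatiR_eq D hh, riccatiR_eq D hh, sub_sub_sub_comm, add_sub_add_right_eq_sub, ← map_sub,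
    add_mul]
  exact (norm_sub_le _ _).trans (add_le_add ((ContinuousLinearMap.adjoint B).le_opNorm _)
    (norm_jumpIntegral_sub_le hM hu hv huM hvM))

/-- For a continuous purely imaginary curve `ψ`, the right hand side `R(ψ(t), u)` satisfies the
hypotheses of the existence and uniqueness theorems in the cone. -/
theorem IsAdmissible.isConeField (h : IsAdmissible b B m μ) (D : H →L[ℝ] H) {ψ : ℝ → Cplx H}
    (hψ : Continuous ψ) (hψi : ∀ t, ψ t ∈ imag H) (T : ℝ) :
    IsConeField (posCone H) (fun t u => riccatiR B D μ (ψ t) u) T := by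
  have hcont : Continuous fun t => tensorSq (sqrtOp D (ψ t).2) :=
    continuous_tensorSq.comp ((sqrtOp D).continuous.comp (continuous_snd.comp hψ))
  refine ⟨fun u _ => ?_, fun M => ?_, fun t _ u hu x hx hux => ?_, ?_⟩
  · simp_rw [riccatiR_eq D (hψi _)]
    fun_prop
  · refine ⟨Real.toNNReal (‖ContinuousLinearMap.adjoint B‖ + max 1 M * (2 * μ.bound)),
      fun t => LipschitzOnWith.of_dist_le_mul fun u hu v hv => ?_⟩
    rw [Real.coe_toNNReal _ (by positivity), dist_eq_norm, dist_eq_norm]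
    exact norm_riccatiR_sub_le D (hψi t) (le_max_left _ _) hu.1 hv.1
      ((mem_closedBall_zero_iff.1 hu.2).trans (le_max_right _ _))
      ((mem_closedBall_zero_iff.1 hv.2).trans (le_max_right _ _))
  · rw [riccatiR_eq D (hψi _), inner_sub_left, inner_add_left, real_inner_smul_left]
    have h1 := h.inner_jumpIntegral_le hu hx hux
    have h2 := inner_nonneg_of_mem_posCone (tensorSq_mem_posCone (sqrtOp D (ψ t).2)) hx
    linarith
  · obtain ⟨N, hN⟩ := (isCompact_Icc (a := (0 : ℝ)) (b := T)).exists_bound_of_continuousOn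
      hcont.continuousOn
    refine ⟨‖ContinuousLinearMap.adjoint B‖ + |N| + 2 * μ.bound, by positivity,
      fun t ht u hu => ?_⟩
    rw [riccatiR_eq D (hψi _), inner_sub_left, inner_add_left, real_inner_smul_left]
    have h1 := neg_inner_jumpIntegral_le h.mu_mem hu hu
    have h2 : ⟪tensorSq (sqrtOp D (ψ t).2), u⟫_ℝ ≤ |N| * ‖u‖ :=
      (real_inner_le_norm _ _).trans (by gcongr; exact (hN t ht).trans (le_abs_self N))
    have h3 : ⟪ContinuousLinearMap.adjoint B u, u⟫_ℝ ≤ ‖ContinuousLinearMap.adjoint B‖ * ‖u‖ ^ 2 :=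
      (real_inner_le_norm _ _).trans (by
        rw [sq, ← mul_assoc]
        gcongr
        exact (ContinuousLinearMap.adjoint B).le_opNorm u)
    have h4 : ‖u‖ ≤ 1 + ‖u‖ ^ 2 := by nlinarith [sq_nonneg (‖u‖ - 1), norm_nonneg u]
    have h5 : ‖u‖ ^ 2 ≤ 1 + ‖u‖ ^ 2 := by linarith
    have h6 := mul_le_mul_of_nonneg_left h4 (abs_nonneg N)
    have h7 := mul_le_mul_of_nonneg_left h4 (by positivity : (0 : ℝ) ≤ 2 * μ.bound)
    have h8 := mul_le_mul_of_nonneg_left h5 (norm_nonneg (ContinuousLinearMap.adjoint B))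
    have h9 : 0 ≤ |N| * ‖u‖ := by positivity
    nlinarith

end RiccatiR

/-! ### Strongly continuous semigroups and their adjoints -/

namespace C0Semigroup

variable {H : Type*} [NormedAddCommGroup H] [InnerProductSpace ℝ H]

/-- The semigroup as a function of a real parameter, equal to the identity for `t ≤ 0`. -/
def evol (S : C0Semigroup H) (t : ℝ) : H →L[ℝ] H := S.toFun t.toNNReal

variable (S : C0Semigroup H)

theorem evol_of_nonpos {t : ℝ} (ht : t ≤ 0) : S.evol t = ContinuousLinearMap.id ℝ H := by
  rw [evol, Real.toNNReal_of_nonpos ht, S.map_zero]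

theorem evol_zero_apply (x : H) : S.evol 0 x = x := by
  rw [S.evol_of_nonpos le_rfl, ContinuousLinearMap.id_apply]

theorem evol_add_apply {s t : ℝ} (hs : 0 ≤ s) (ht : 0 ≤ t) (x : H) :
    S.evol (s + t) x = S.evol s (S.evol t x) := by
  rw [evol, Real.toNNReal_add hs ht, S.map_add]
  rfl

theorem continuous_evol (x : H) : Continuous fun t => S.evol t x :=
  (S.continuous x).comp continuous_real_toNNReal

theorem intervalIntegrable_evol (x : H) (a b : ℝ) :
    IntervalIntegrable (fun s => S.evol s x) volume a b :=
  (S.continuous_evol x).intervalIntegrable a b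

theorem IsGenerator.evol_mem_graph {S : C0Semigroup H} {A : H →ₗ.[ℝ] H}
    (hA : S.IsGenerator A) {x y : H} (hxy : (x, y) ∈ A.graph) {t : ℝ} (ht : 0 ≤ t) :
    (S.evol t x, S.evol t y) ∈ A.graph := by
  rw [hA]
  refine (((S.evol t).continuous.tendsto y).comp ((hA x y).1 hxy)).congr fun h => ?_
  have h1 := S.evol_add_apply ht h.coe_nonneg x
  rw [add_comm, S.evol_add_apply h.coe_nonneg ht] at h1
  rw [Function.comp_apply, map_smul, map_sub]
  congr 2
  simpa [evol] using h1.symm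

variable [CompleteSpace H]

theorem exists_norm_evol_le (T : ℝ) : ∃ M : ℝ, 0 ≤ M ∧ ∀ t ≤ T, ‖S.evol t‖ ≤ M := by
  have hpt : ∀ x, ∃ C, ∀ t : Icc 0 (max T 0), ‖S.evol t x‖ ≤ C := fun x => by
    obtain ⟨C, hC⟩ := (isCompact_Icc (a := (0 : ℝ)) (b := max T 0)).exists_bound_of_continuousOn
      (S.continuous_evol x).continuousOn
    exact ⟨C, fun t => hC t t.2⟩
  obtain ⟨M, hM⟩ := banach_steinhaus hpt
  have h0 := hM ⟨0, le_rfl, le_max_right _ _⟩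
  refine ⟨M, (norm_nonneg _).trans h0, fun t ht => ?_⟩
  rcases le_total t 0 with h | h
  · rw [S.evol_of_nonpos h, ← S.evol_of_nonpos le_rfl]
    exact h0
  · exact hM ⟨t, h, ht.trans (le_max_left _ _)⟩

theorem exists_norm_integral_le (T : ℝ) : ∃ M : ℝ, 0 ≤ M ∧ ∀ t, |t| ≤ T → ∀ x,
    ‖∫ s in (0 : ℝ)..t, S.evol s x‖ ≤ M * |t| * ‖x‖ := by
  obtain ⟨M, hM0, hM⟩ := S.exists_norm_evol_le T
  refine ⟨M, hM0, fun t ht x => ?_⟩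
  have h := intervalIntegral.norm_integral_le_of_norm_le_const (a := 0) (b := t)
    (f := fun s => S.evol s x) (C := M * ‖x‖) fun s hs => by
      have hs' : s ≤ T := hs.2.trans (max_le ((abs_nonneg t).trans ht) ((le_abs_self t).trans ht))
      exact (S.evol s).le_of_opNorm_le (hM s hs') x
  rw [sub_zero] at h
  linarith

/-- The operator `x ↦ ∫₀ᵗ S(s) x ds`. -/
noncomputable def integralOp (t : ℝ) : H →L[ℝ] H :=
  LinearMap.mkContinuousOfExistsBound
    { toFun := fun x => ∫ s in (0 : ℝ)..t, S.evol s x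
      map_add' := fun x y => by
        simp only [_root_.map_add]
        exact intervalIntegral.integral_add (S.intervalIntegrable_evol x _ _)
          (S.intervalIntegrable_evol y _ _)
      map_smul' := fun c x => by
        simp_rw [map_smul]
        exact intervalIntegral.integral_smul _ _ } <| by
    obtain ⟨M, -, hM⟩ := S.exists_norm_integral_le |t|
    exact ⟨M * |t|, fun x => hM t le_rfl x⟩

theorem integralOp_apply (t : ℝ) (x : H) : S.integralOp t x = ∫ s in (0 : ℝ)..t, S.evol s x := rfl

theorem hasDerivAt_integralOp (t : ℝ) (x : H) :
    HasDerivAt (fun t => S.integralOp t x) (S.evol t x) t :=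
  intervalIntegral.integral_hasDerivAt_right (S.intervalIntegrable_evol x _ _)
    ((S.continuous_evol x).stronglyMeasurableAtFilter _ _) (S.continuous_evol x).continuousAt

theorem integralOp_evol {t h : ℝ} (ht : 0 ≤ t) (hh : 0 ≤ h) (x : H) :
    S.integralOp t (S.evol h x) = S.integralOp (t + h) x - S.integralOp h x := by
  simp only [integralOp_apply]
  rw [intervalIntegral.integral_interval_sub_left (S.intervalIntegrable_evol x _ _)
    (S.intervalIntegrable_evol x _ _)]
  have : ∫ s in (0 : ℝ)..t, S.evol s (S.evol h x) = ∫ s in (0 : ℝ)..t, S.evol (s + h) x := by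
    refine intervalIntegral.integral_congr fun s hs => ?_
    rw [uIcc_of_le ht] at hs
    exact (S.evol_add_apply hs.1 hh x).symm
  rw [this, intervalIntegral.integral_comp_add_right (fun s => S.evol s x), zero_add]

/-- Both sides are equal to `∫₀ᵗ⁺ʰ S(s) x ds - ∫₀ᵗ S(s) x ds - ∫₀ʰ S(s) x ds`. -/
theorem integralOp_evol_sub {t h : ℝ} (ht : 0 ≤ t) (hh : 0 ≤ h) (x : H) :
    S.integralOp t (S.evol h x - x) = S.integralOp h (S.evol t x - x) := by
  rw [map_sub, map_sub, S.integralOp_evol ht hh, S.integralOp_evol hh ht, add_comm h t]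
  abel

theorem evol_integralOp {t h : ℝ} (ht : 0 ≤ t) (hh : 0 ≤ h) (x : H) :
    S.evol h (S.integralOp t x) = S.integralOp t (S.evol h x) := by
  rw [integralOp_apply, ← ContinuousLinearMap.intervalIntegral_comp_comm _
    (S.intervalIntegrable_evol x _ _), integralOp_apply]
  refine intervalIntegral.integral_congr fun s hs => ?_
  rw [uIcc_of_le ht] at hs
  change S.evol h (S.evol s x) = S.evol s (S.evol h x)
  rw [← S.evol_add_apply hh hs.1, ← S.evol_add_apply hs.1 hh, add_comm]

theorem tendsto_inv_smul_integralOp (x : H) :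
    Tendsto (fun h : ℝ≥0 => (h : ℝ)⁻¹ • S.integralOp h x) (𝓝[≠] 0) (𝓝 x) := by
  have h1 := (S.hasDerivAt_integralOp 0 x).tendsto_slope_zero
  have h0 : S.integralOp 0 x = 0 := by simp [integralOp_apply]
  simp only [zero_add, S.evol_zero_apply, h0, sub_zero] at h1
  refine h1.comp (tendsto_nhdsWithin_iff.2 ⟨?_, ?_⟩)
  · exact (NNReal.continuous_coe.tendsto' 0 0 rfl).mono_left nhdsWithin_le_nhds
  · filter_upwards [self_mem_nhdsWithin] with h hh
    simpa using hh

section Generator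

variable {S} {A : H →ₗ.[ℝ] H}

theorem IsGenerator.integralOp_mem_graph (hA : S.IsGenerator A) {t : ℝ} (ht : 0 ≤ t) (x : H) :
    (S.integralOp t x, S.evol t x - x) ∈ A.graph := by
  rw [hA]
  refine (S.tendsto_inv_smul_integralOp (S.evol t x - x)).congr fun h => ?_
  rw [← S.integralOp_evol_sub ht h.coe_nonneg, map_sub, ← S.evol_integralOp ht h.coe_nonneg, evol, Real.toNNReal_coe]

theorem IsGenerator.dense_domain (hA : S.IsGenerator A) : Dense (A.domain : Set H) := fun x => by
  refine mem_closure_of_tendsto (S.tendsto_inv_smul_integralOp x)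
    (Eventually.of_forall fun h => ?_)
  exact A.domain.smul_mem _ (LinearPMap.mem_domain_of_mem_graph (hA.integralOp_mem_graph h.coe_nonneg x))

theorem IsGenerator.integralOp_eq (hA : S.IsGenerator A) {x y : H} (hxy : (x, y) ∈ A.graph)
    {t : ℝ} (ht : 0 ≤ t) : S.integralOp t y = S.evol t x - x := by
  have h1 := ((S.integralOp t).continuous.tendsto y).comp ((hA x y).1 hxy)
  refine tendsto_nhds_unique h1
    ((S.tendsto_inv_smul_integralOp (S.evol t x - x)).congr fun h => ?_)
  rw [← S.integralOp_evol_sub ht h.coe_nonneg, Function.comp_apply, map_smul, evol, Real.toNNReal_coe]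

open LinearPMap in
theorem IsGenerator.mem_adjoint_graph_iff (hA : S.IsGenerator A) {x z : H} :
    (x, z) ∈ A†.graph ↔ ∀ a b, (a, b) ∈ A.graph → ⟪b, x⟫_ℝ = ⟪a, z⟫_ℝ := by
  rw [LinearPMap.adjoint_graph_eq_graph_adjoint hA.dense_domain, Submodule.mem_adjoint_iff]
  simp only [sub_eq_zero]

end Generator

/-- The averages `∫₀ʳ S(s)^* x ds` are continuity points of the adjoint semigroup. -/
theorem tendsto_adjoint_evol_integralOp {r : ℝ} (hr : 0 ≤ r) (x : H) :
    Tendsto (fun h => ContinuousLinearMap.adjoint (S.evol h)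
      (ContinuousLinearMap.adjoint (S.integralOp r) x)) (𝓝 0)
      (𝓝 (ContinuousLinearMap.adjoint (S.integralOp r) x)) := by
  obtain ⟨M, hM0, hM⟩ := S.exists_norm_integral_le 1
  set C := M * ‖S.evol r - ContinuousLinearMap.id ℝ H‖ * ‖x‖ with hC
  have hC0 : 0 ≤ C := by positivity
  rw [tendsto_iff_norm_sub_tendsto_zero]
  have hlim : Tendsto (fun h : ℝ => C * |h|) (𝓝 0) (𝓝 0) := by
    have : Continuous fun h : ℝ => C * |h| := by fun_prop
    exact this.tendsto' 0 0 (by simp)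
  refine squeeze_zero' (Eventually.of_forall fun _ => norm_nonneg _) ?_ hlim
  filter_upwards [Metric.ball_mem_nhds (0 : ℝ) one_pos] with h hh
  have hh1 : |h| ≤ 1 := by
    rw [mem_ball_zero_iff] at hh
    exact hh.le
  rcases le_total h 0 with h0 | h0
  · rw [S.evol_of_nonpos h0, ContinuousLinearMap.adjoint_id, ContinuousLinearMap.id_apply, sub_self,
      norm_zero]
    positivity
  · have h1 : ContinuousLinearMap.adjoint (S.evol h) (ContinuousLinearMap.adjoint (S.integralOp r) x)
          - ContinuousLinearMap.adjoint (S.integralOp r) x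
        = ContinuousLinearMap.adjoint
          (S.integralOp h ∘L (S.evol r - ContinuousLinearMap.id ℝ H)) x := by
      refine ext_inner_right ℝ fun y => ?_
      rw [inner_sub_left, ContinuousLinearMap.adjoint_inner_left,
        ContinuousLinearMap.adjoint_inner_left, ContinuousLinearMap.adjoint_inner_left,
        ContinuousLinearMap.adjoint_inner_left, ← inner_sub_right, ← map_sub,
        S.integralOp_evol_sub hr h0]
      rfl
    rw [h1]
    have h2 : ‖S.integralOp h‖ ≤ M * |h| :=
      ContinuousLinearMap.opNorm_le_bound _ (by positivity) (hM h hh1)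
    calc _ ≤ ‖ContinuousLinearMap.adjoint
          (S.integralOp h ∘L (S.evol r - ContinuousLinearMap.id ℝ H))‖ * ‖x‖ :=
          ContinuousLinearMap.le_opNorm _ _
      _ = ‖S.integralOp h ∘L (S.evol r - ContinuousLinearMap.id ℝ H)‖ * ‖x‖ := by
          rw [LinearIsometryEquiv.norm_map]
      _ ≤ (M * |h| * ‖S.evol r - ContinuousLinearMap.id ℝ H‖) * ‖x‖ := by
          gcongr
          exact (ContinuousLinearMap.opNorm_comp_le _ _).trans (by gcongr)
      _ = C * |h| := by ring

/-- The adjoint semigroup is strongly continuous at `0`: its continuity points form a closed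
subspace, whose orthogonal complement is annihilated by all operators `∫₀ʳ S(s) ds`. -/
theorem tendsto_adjoint_evol_zero (x : H) :
    Tendsto (fun h => ContinuousLinearMap.adjoint (S.evol h) x) (𝓝 0) (𝓝 x) := by
  let D : Submodule ℝ H :=
    { carrier := {x | Tendsto (fun h => ContinuousLinearMap.adjoint (S.evol h) x) (𝓝 0) (𝓝 x)}
      zero_mem' := by simp
      add_mem' := fun {x y} hx hy => by
        simp only [mem_ofPred_eq, _root_.map_add] at *
        exact hx.add hy
      smul_mem' := fun c x hx => by
        simp only [mem_ofPred_eq, map_smul] at *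
        exact hx.const_smul c }
  have hD : Dᗮ = ⊥ := by
    rw [Submodule.eq_bot_iff]
    intro y hy
    have h1 : ∀ r : ℝ≥0, S.integralOp r y = 0 := fun r => by
      have h2 := (Submodule.mem_orthogonal _ _).1 hy _
        (S.tendsto_adjoint_evol_integralOp r.2 (S.integralOp r y) : _ ∈ D)
      rw [ContinuousLinearMap.adjoint_inner_left] at h2
      exact inner_self_eq_zero.1 h2
    have h3 := S.tendsto_inv_smul_integralOp y
    simp only [h1, smul_zero] at h3
    exact tendsto_nhds_unique h3 tendsto_const_nhds
  have hdense : Dense (D : Set H) := by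
    rw [Submodule.dense_iff_topologicalClosure_eq_top, Submodule.topologicalClosure_eq_top_iff, hD]
  obtain ⟨M, hM0, hM⟩ := S.exists_norm_evol_le 1
  rw [Metric.tendsto_nhds]
  intro ε hε
  obtain ⟨y, hy, hxy⟩ := hdense.exists_dist_lt x (show 0 < ε / (2 * (M + 1)) by positivity)
  have hyD : Tendsto (fun h => ContinuousLinearMap.adjoint (S.evol h) y) (𝓝 0) (𝓝 y) := hy
  filter_upwards [Metric.tendsto_nhds.1 hyD (ε / 2) (by positivity), Iio_mem_nhds one_pos]
    with h h1 h2
  have h3 : dist (ContinuousLinearMap.adjoint (S.evol h) x) (ContinuousLinearMap.adjoint (S.evol h) y)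
      ≤ M * dist x y := by
    rw [dist_eq_norm, dist_eq_norm, ← map_sub]
    refine ContinuousLinearMap.le_of_opNorm_le _ ?_ _
    rw [LinearIsometryEquiv.norm_map]
    exact hM h (le_of_lt h2)
  have h4 := dist_triangle4 (ContinuousLinearMap.adjoint (S.evol h) x)
    (ContinuousLinearMap.adjoint (S.evol h) y) y x
  rw [dist_comm y x] at h4
  rw [lt_div_iff₀ (by positivity)] at hxy
  linarith

/-- The adjoint of a strongly continuous semigroup on a Hilbert space is strongly continuous. -/
theorem continuous_adjoint_evol (x : H) :
    Continuous fun t => ContinuousLinearMap.adjoint (S.evol t) x := by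
  have hnn : Continuous fun t : ℝ≥0 => ContinuousLinearMap.adjoint (S.toFun t) x := by
    rw [continuous_iff_continuousAt]
    intro t
    obtain ⟨M, hM0, hM⟩ := S.exists_norm_evol_le (t + 1)
    have hkey : ∀ s r : ℝ≥0, s ≤ r → (s : ℝ) ≤ t + 1 →
        ‖ContinuousLinearMap.adjoint (S.toFun r) x - ContinuousLinearMap.adjoint (S.toFun s) x‖ ≤
          M * ‖ContinuousLinearMap.adjoint (S.evol |(r : ℝ) - s|) x - x‖ := fun s r hsr hs => by
      obtain ⟨d, rfl⟩ := exists_add_of_le hsr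
      have h1 : ContinuousLinearMap.adjoint (S.toFun (s + d)) x =
          ContinuousLinearMap.adjoint (S.toFun s) (ContinuousLinearMap.adjoint (S.toFun d) x) := by
        rw [add_comm, S.map_add, ContinuousLinearMap.adjoint_comp, ContinuousLinearMap.comp_apply]
      have h2 : S.evol |((s + d : ℝ≥0) : ℝ) - s| = S.toFun d := by
        simp [evol]
      rw [h1, h2, ← map_sub]
      refine ContinuousLinearMap.le_of_opNorm_le _ ?_ _
      rw [LinearIsometryEquiv.norm_map]
      simpa [evol] using hM s hs
    rw [ContinuousAt, tendsto_iff_norm_sub_tendsto_zero]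
    have hlim : Tendsto (fun s : ℝ≥0 =>
        M * ‖ContinuousLinearMap.adjoint (S.evol |(s : ℝ) - t|) x - x‖) (𝓝 t) (𝓝 0) := by
      have h1 : Tendsto (fun s : ℝ≥0 => |(s : ℝ) - t|) (𝓝 t) (𝓝 0) := by
        have : Continuous fun s : ℝ≥0 => |(s : ℝ) - t| := by fun_prop
        exact this.tendsto' t 0 (by simp)
      have h2 := tendsto_iff_norm_sub_tendsto_zero.1 ((S.tendsto_adjoint_evol_zero x).comp h1)
      simpa using h2.const_mul M
    refine squeeze_zero' (Eventually.of_forall fun _ => norm_nonneg _) ?_ hlim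
    have hev : ∀ᶠ s : ℝ≥0 in 𝓝 t, s < t + 1 := Iio_mem_nhds (lt_add_one t)
    filter_upwards [hev] with s hs
    rcases le_total s t with h | h
    · rw [norm_sub_rev, abs_sub_comm]
      exact hkey s t h (by exact_mod_cast hs.le)
    · exact hkey t s h (by simp)
  exact hnn.comp continuous_real_toNNReal

section Generator

variable {S} {A : H →ₗ.[ℝ] H}

open LinearPMap in
/-- The orbits of the adjoint semigroup are mild solutions of `φ' = A^* φ`. -/
theorem IsGenerator.integral_adjoint_mem_graph (hA : S.IsGenerator A) {t : ℝ} (ht : 0 ≤ t)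
    (g : H) : (∫ s in (0 : ℝ)..t, ContinuousLinearMap.adjoint (S.evol s) g,
      ContinuousLinearMap.adjoint (S.evol t) g - g) ∈ A†.graph := by
  refine hA.mem_adjoint_graph_iff.2 fun a b hab => ?_
  have hint := (S.continuous_adjoint_evol g).intervalIntegrable (μ := volume) 0 t
  have h1 : ⟪b, ∫ s in (0 : ℝ)..t, ContinuousLinearMap.adjoint (S.evol s) g⟫_ℝ
      = ⟪S.integralOp t b, g⟫_ℝ := by
    rw [← innerSL_apply_apply ℝ b, ← ContinuousLinearMap.intervalIntegral_comp_comm _ hint,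
      real_inner_comm, integralOp_apply, ← innerSL_apply_apply ℝ g,
      ← ContinuousLinearMap.intervalIntegral_comp_comm _ (S.intervalIntegrable_evol b _ _)]
    refine intervalIntegral.integral_congr fun s _ => ?_
    simp only [innerSL_apply_apply]
    rw [ContinuousLinearMap.adjoint_inner_right, real_inner_comm]
  rw [h1, hA.integralOp_eq hab ht, inner_sub_left, inner_sub_right,
    ContinuousLinearMap.adjoint_inner_right]

/-- Uniqueness of mild solutions of `φ' = A^* φ`: if `x(t) = ∫₀ᵗ δ` and `x' = A^* x`, then
`s ↦ ⟪S(t - s) a, x(s)⟫` is constant for `a` in the domain of `A`. -/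
theorem IsGenerator.eq_zero_of_mild (hA : S.IsGenerator A) {δ : ℝ → H} (hδ : Continuous δ) {T : ℝ}
    (h : ∀ t ∈ Icc 0 T, ∀ a b, (a, b) ∈ A.graph →
      ⟪b, ∫ s in (0 : ℝ)..t, δ s⟫_ℝ = ⟪a, δ t⟫_ℝ) : ∀ t ∈ Icc 0 T, δ t = 0 := by
  have hx : ∀ t ∈ Icc 0 T, ∫ s in (0 : ℝ)..t, δ s = 0 := fun t ht => by
    refine hA.dense_domain.eq_zero_of_inner_right ℝ fun a ha => ?_
    obtain ⟨b, hab⟩ := LinearPMap.mem_domain_iff.1 ha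
    have hder : ∀ s, HasDerivAt (fun s => ⟪a + S.integralOp (t - s) b, ∫ r in (0 : ℝ)..s, δ r⟫_ℝ)
        (⟪a + S.integralOp (t - s) b, δ s⟫_ℝ +
          ⟪-S.evol (t - s) b, ∫ r in (0 : ℝ)..s, δ r⟫_ℝ) s := fun s => by
      have h1 : HasDerivAt (fun s => a + S.integralOp (t - s) b) (-S.evol (t - s) b) s :=
        ((S.hasDerivAt_integralOp (t - s) b).comp_const_sub t s).const_add a
      exact h1.inner ℝ (hδ.integral_hasStrictDerivAt 0 s).hasDerivAt
    have hzero : ∀ s ∈ Ico 0 t, HasDerivWithinAt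
        (fun s => ⟪a + S.integralOp (t - s) b, ∫ r in (0 : ℝ)..s, δ r⟫_ℝ) 0 (Ici s) s :=
      fun s hs => by
        have hts : 0 ≤ t - s := sub_nonneg.2 hs.2.le
        have h1 := h s ⟨hs.1, hs.2.le.trans ht.2⟩ _ _ (hA.evol_mem_graph hab hts)
        have h2 := (hder s).hasDerivWithinAt (s := Ici s)
        rwa [hA.integralOp_eq hab hts, add_sub_cancel, inner_neg_left, h1, add_neg_cancel] at h2
    have hconst := constant_of_has_deriv_right_zero
      (fun s _ => (hder s).continuousAt.continuousWithinAt) hzero t ⟨ht.1, le_rfl⟩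
    simpa [integralOp_apply, sub_self, real_inner_comm] using hconst
  intro t ht
  refine hA.dense_domain.eq_zero_of_inner_right ℝ fun a ha => ?_
  obtain ⟨b, hab⟩ := LinearPMap.mem_domain_iff.1 ha
  have h1 := h t ht a b hab
  rw [hx t ht, inner_zero_right] at h1
  exact h1.symm

end Generator

end C0Semigroup

/-! ### Mild solutions -/

section OneSided

variable {E : Type*} [NormedAddCommGroup E] [NormedSpace ℝ E] {f v : ℝ → E} {T : ℝ}

/-- A `C¹` function that satisfies a differential equation on `(0, T]` satisfies it at `0` too. -/
theorem hasDerivWithinAt_Icc_of_Ioc (hT : 0 < T) (hf : ContDiffOn ℝ 1 f (Icc 0 T))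
    (hv : ContinuousOn v (Icc 0 T))
    (h : ∀ t ∈ Ioc 0 T, HasDerivWithinAt f (v t) (Icc 0 T) t) :
    ∀ t ∈ Icc 0 T, HasDerivWithinAt f (v t) (Icc 0 T) t := by
  have hu := uniqueDiffOn_Icc hT
  obtain ⟨hd, hc⟩ := (contDiffOn_one_iff_derivWithin hu).1 hf
  have heq : EqOn (derivWithin f (Icc 0 T)) v (Ioc 0 T) := fun t ht =>
    (h t ht).derivWithin (hu t (Ioc_subset_Icc_self ht))
  have heq' := heq.of_subset_closure hc hv Ioc_subset_Icc_self (closure_Ioc hT.ne).ge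
  intro t ht
  rw [← heq' ht]
  exact (hd t ht).hasDerivWithinAt

theorem contDiffOn_one_of_hasDerivWithinAt (hT : 0 < T) (hv : ContinuousOn v (Icc 0 T))
    (h : ∀ t ∈ Icc 0 T, HasDerivWithinAt f (v t) (Icc 0 T) t) : ContDiffOn ℝ 1 f (Icc 0 T) := by
  have hu := uniqueDiffOn_Icc hT
  refine (contDiffOn_one_iff_derivWithin hu).2
    ⟨fun t ht => (h t ht).differentiableWithinAt, hv.congr fun t ht => ?_⟩
  exact (h t ht).derivWithin (hu t ht)

theorem eqOn_of_hasDerivWithinAt_Icc {g : ℝ → E}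
    (hf : ∀ t ∈ Icc 0 T, HasDerivWithinAt f (v t) (Icc 0 T) t)
    (hg : ∀ t ∈ Icc 0 T, HasDerivWithinAt g (v t) (Icc 0 T) t) (h0 : f 0 = g 0) :
    EqOn f g (Icc 0 T) := by
  intro t ht
  have h := constant_of_has_deriv_right_zero (f := fun t => f t - g t) (a := 0) (b := T)
    (fun s hs => ((hf s hs).sub (hg s hs)).continuousWithinAt)
    (fun s hs => by
      have hs' := Ico_subset_Icc_self hs
      have := (hf s hs').fun_sub (hg s hs')
      rw [sub_self] at this
      exact this.mono_of_mem_nhdsWithin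
        (mem_of_superset (Icc_mem_nhdsGE hs.2) (Icc_subset_Icc_left hs.1))) t ht
  simpa [h0, sub_eq_zero] using h

end OneSided

section MildSolution

variable {H : Type*} [NormedAddCommGroup H] [InnerProductSpace ℝ H] [CompleteSpace H]
variable {b : SHS H} {B : SHS H →L[ℝ] SHS H} {m : Measure (Jump H)}
  {μ : VectorMeasure (Jump H) (SHS H)} {S : C0Semigroup H} {A : H →ₗ.[ℝ] H} {D : H →L[ℝ] H}
  {u₁ : Cplx H} {u₂ : SHS H} {T : ℝ} {Φ : ℝ → ℝ} {ψ₁ : ℝ → Cplx H} {ψ₂ : ℝ → SHS H}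

/-- The first component `t ↦ -i S(t)^* (i u₁) = i S(t)^* g` of the mild solution, for
`u₁ = i g`. -/
noncomputable def imagOrbit (S : C0Semigroup H) (g : H) (t : ℝ) : Cplx H :=
  (0, ContinuousLinearMap.adjoint (S.evol t) g)

theorem continuous_imagOrbit (S : C0Semigroup H) (g : H) : Continuous (imagOrbit S g) :=
  continuous_const.prodMk (S.continuous_adjoint_evol g)

theorem imagOrbit_mem (S : C0Semigroup H) (g : H) (t : ℝ) : imagOrbit S g t ∈ imag H := rfl

theorem imagOrbit_eq (S : C0Semigroup H) {u₁ : Cplx H} (hu₁ : u₁ ∈ imag H) (t : ℝ) :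
    imagOrbit S u₁.2 t =
      -mulI (extend (ContinuousLinearMap.adjoint (S.toFun t.toNNReal)) (mulI u₁)) := by
  have h : u₁.1 = 0 := hu₁
  ext <;> simp [imagOrbit, mulI, extend, h, C0Semigroup.evol]

theorem snd_intervalIntegral {ψ : ℝ → Cplx H} {t : ℝ} (hψ : IntervalIntegrable ψ volume 0 t) :
    (∫ s in (0 : ℝ)..t, ψ s).2 = ∫ s in (0 : ℝ)..t, (ψ s).2 :=
  ((ContinuousLinearMap.snd ℝ H H).intervalIntegral_comp_comm hψ).symm

theorem fst_intervalIntegral {ψ : ℝ → Cplx H} {t : ℝ} (hψ : IntervalIntegrable ψ volume 0 t) :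
    (∫ s in (0 : ℝ)..t, ψ s).1 = ∫ s in (0 : ℝ)..t, (ψ s).1 :=
  ((ContinuousLinearMap.fst ℝ H H).intervalIntegral_comp_comm hψ).symm

open LinearPMap in
/-- `ψ₁ = imagOrbit` solves the second equation. -/
theorem imagOrbit_mild (hA : S.IsGenerator A) (hu₁ : u₁ ∈ imag H) {t : ℝ} (ht : 0 ≤ t) :
    ∃ w, ExtendGraph A† (mulI (∫ s in (0 : ℝ)..t, imagOrbit S u₁.2 s)) w ∧
      imagOrbit S u₁.2 t = u₁ - mulI w := by
  have hint := (continuous_imagOrbit S u₁.2).intervalIntegrable (μ := volume) 0 t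
  have h1 : u₁.1 = 0 := hu₁
  have hmem := hA.integral_adjoint_mem_graph ht u₁.2
  refine ⟨(-(ContinuousLinearMap.adjoint (S.evol t) u₁.2 - u₁.2), 0), ⟨?_, ?_⟩, ?_⟩
  · simp only [mulI, snd_intervalIntegral hint]
    exact A†.graph.neg_mem hmem
  · have h2 : (∫ s in (0 : ℝ)..t, imagOrbit S u₁.2 s).1 = 0 := by
      rw [fst_intervalIntegral hint]
      exact intervalIntegral.integral_zero
    simp only [mulI, h2]
    exact A†.graph.zero_mem
  · ext <;> simp [imagOrbit, mulI, h1]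

open LinearPMap in
/-- The second equation determines `ψ₁`. -/
theorem IsMildSolution.eqOn_psi₁ (h : IsMildSolution b B m μ A D u₁ u₂ T Φ ψ₁ ψ₂)
    (hA : S.IsGenerator A) (hT : 0 ≤ T) : EqOn ψ₁ (imagOrbit S u₁.2) (Icc 0 T) := by
  have hu₁ : u₁ ∈ imag H := by
    rw [← h.psi₁_zero]
    exact h.psi₁_mem 0 ⟨le_rfl, hT⟩
  set f : ℝ → H := fun t => (ψ₁ (projIcc 0 T hT t)).2 with hf
  have hfc : Continuous f :=
    continuous_snd.comp (h.psi₁_cont.comp_continuous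
      (continuous_subtype_val.comp continuous_projIcc) fun t => (projIcc 0 T hT t).2)
  have hfe : ∀ t ∈ Icc 0 T, f t = (ψ₁ t).2 := fun t ht => by
    simp [hf, projIcc_of_mem hT ht]
  have hφc := S.continuous_adjoint_evol u₁.2
  have hdiff : ∀ t ∈ Icc 0 T, f t - ContinuousLinearMap.adjoint (S.evol t) u₁.2 = 0 := by
    refine hA.eq_zero_of_mild (hfc.fun_sub hφc) fun t ht a c hac => ?_
    rcases ht.1.eq_or_lt with h0 | h0
    · subst h0
      have h1 : f 0 = u₁.2 := by rw [hfe 0 ht, h.psi₁_zero]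
      simp [h1, S.evol_of_nonpos le_rfl, ContinuousLinearMap.adjoint_id]
    · obtain ⟨w, ⟨hw, -⟩, hψ⟩ := h.psi₁_eq t ⟨h0, ht.2⟩
      have hsub : uIcc 0 t ⊆ Icc 0 T := by
        rw [uIcc_of_le ht.1]
        exact Icc_subset_Icc_right ht.2
      have hint : IntervalIntegrable ψ₁ volume 0 t := (h.psi₁_cont.mono hsub).intervalIntegrable
      have h1 : (mulI (∫ s in (0 : ℝ)..t, ψ₁ s)).1 = -∫ s in (0 : ℝ)..t, f s := by
        rw [mulI, snd_intervalIntegral hint]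
        exact congrArg _ (intervalIntegral.integral_congr fun s hs => (hfe s (hsub hs)).symm)
      have h2 : w.1 = u₁.2 - f t := by
        rw [hfe t ht, hψ]
        simp [mulI]
      rw [h1, h2] at hw
      have h3 := hA.mem_adjoint_graph_iff.1 hw a c hac
      have h4 := hA.mem_adjoint_graph_iff.1 (hA.integral_adjoint_mem_graph ht.1 u₁.2) a c hac
      rw [intervalIntegral.integral_sub (hfc.intervalIntegrable _ _) (hφc.intervalIntegrable _ _)]
      simp only [inner_sub_right, inner_neg_right] at *
      linarith
  intro t ht
  have h1 : (ψ₁ t).1 = 0 := h.psi₁_mem t ht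
  have h2 := sub_eq_zero.1 (hdiff t ht)
  rw [hfe t ht] at h2
  exact Prod.ext h1 h2

theorem IsMildSolution.psi₂_hasDerivWithinAt (h : IsMildSolution b B m μ A D u₁ u₂ T Φ ψ₁ ψ₂)
    (hadm : IsAdmissible b B m μ) (hA : S.IsGenerator A) (hT : 0 < T) :
    ∀ t ∈ Icc 0 T, HasDerivWithinAt ψ₂ (riccatiR B D μ (imagOrbit S u₁.2 t) (ψ₂ t)) (Icc 0 T) t := by
  have hfield := hadm.isConeField D (continuous_imagOrbit S u₁.2) (imagOrbit_mem S u₁.2) T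
  refine hasDerivWithinAt_Icc_of_Ioc hT h.psi₂_C1
    (hfield.continuousOn_comp h.psi₂_C1.continuousOn h.psi₂_mem) fun t ht => ?_
  rw [← h.eqOn_psi₁ hA hT.le (Ioc_subset_Icc_self ht)]
  exact h.psi₂_eq t ht

theorem IsMildSolution.Phi_hasDerivWithinAt (h : IsMildSolution b B m μ A D u₁ u₂ T Φ ψ₁ ψ₂)
    (hadm : IsAdmissible b B m μ) (hT : 0 < T) :
    ∀ t ∈ Icc 0 T, HasDerivWithinAt Φ (riccatiF b m (ψ₂ t)) (Icc 0 T) t :=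
  hasDerivWithinAt_Icc_of_Ioc hT h.Phi_C1
    (hadm.continuousOn_riccatiF.comp h.psi₂_C1.continuousOn h.psi₂_mem) h.Phi_eq

theorem IsMildSolution.eqOn {Φ' : ℝ → ℝ} {ψ₁' : ℝ → Cplx H} {ψ₂' : ℝ → SHS H}
    (h' : IsMildSolution b B m μ A D u₁ u₂ T Φ' ψ₁' ψ₂')
    (h : IsMildSolution b B m μ A D u₁ u₂ T Φ ψ₁ ψ₂)
    (hadm : IsAdmissible b B m μ) (hA : S.IsGenerator A) (hT : 0 ≤ T) :
    EqOn Φ' Φ (Icc 0 T) ∧ EqOn ψ₁' ψ₁ (Icc 0 T) ∧ EqOn ψ₂' ψ₂ (Icc 0 T) := by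
  refine ⟨?_, (h'.eqOn_psi₁ hA hT).trans (h.eqOn_psi₁ hA hT).symm, ?_⟩ <;>
    rcases hT.eq_or_lt with rfl | hT
  · simp [h.Phi_zero, h'.Phi_zero]
  · have h2 : EqOn ψ₂' ψ₂ (Icc 0 T) :=
      (hadm.isConeField D (continuous_imagOrbit S u₁.2) (imagOrbit_mem S u₁.2) T).eqOn_of_solution
        (fun t ht => ⟨h'.psi₂_mem t ht, h'.psi₂_hasDerivWithinAt hadm hA hT t ht⟩)
        (fun t ht => ⟨h.psi₂_mem t ht, h.psi₂_hasDerivWithinAt hadm hA hT t ht⟩)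
        (h'.psi₂_zero.trans h.psi₂_zero.symm)
    refine eqOn_of_hasDerivWithinAt_Icc (fun t ht => ?_) (h.Phi_hasDerivWithinAt hadm hT)
      (h'.Phi_zero.trans h.Phi_zero.symm)
    rw [← h2 ht]
    exact h'.Phi_hasDerivWithinAt hadm hT t ht
  · simp [h.psi₂_zero, h'.psi₂_zero]
  · exact
      (hadm.isConeField D (continuous_imagOrbit S u₁.2) (imagOrbit_mem S u₁.2) T).eqOn_of_solution
        (fun t ht => ⟨h'.psi₂_mem t ht, h'.psi₂_hasDerivWithinAt hadm hA hT t ht⟩)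
        (fun t ht => ⟨h.psi₂_mem t ht, h.psi₂_hasDerivWithinAt hadm hA hT t ht⟩)
        (h'.psi₂_zero.trans h.psi₂_zero.symm)

theorem exists_isMildSolution (hadm : IsAdmissible b B m μ) (hA : S.IsGenerator A) (D : H →L[ℝ] H)
    (hu₁ : u₁ ∈ imag H) (hu₂ : u₂ ∈ posCone H) (hT : 0 ≤ T) :
    ∃ Φ ψ₂, IsMildSolution b B m μ A D u₁ u₂ T Φ (imagOrbit S u₁.2) ψ₂ := by
  -- Solving on `[0, T + 1]` avoids a degenerate interval if `T = 0`.
  have hT' : 0 < T + 1 := by linarith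
  have hsub : Icc 0 T ⊆ Icc 0 (T + 1) := Icc_subset_Icc_right (by linarith)
  have hfield := hadm.isConeField D (continuous_imagOrbit S u₁.2) (imagOrbit_mem S u₁.2) (T + 1)
  obtain ⟨y, hy0, hy⟩ := hfield.exists_solution (isSelfDual_posCone H) hT'.le hu₂
  have hyc : ContinuousOn y (Icc 0 (T + 1)) := fun t ht => (hy t ht).2.continuousWithinAt
  set f : ℝ → ℝ := fun t => riccatiF b m (y (projIcc 0 (T + 1) hT'.le t)) with hf
  have hfc : Continuous f := hadm.continuousOn_riccatiF.comp_continuous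
    (hyc.comp_continuous (continuous_subtype_val.comp continuous_projIcc)
      fun t => (projIcc 0 (T + 1) hT'.le t).2)
    fun t => (hy _ (projIcc 0 (T + 1) hT'.le t).2).1
  have hder : ∀ t, HasDerivAt (fun t => ∫ s in (0 : ℝ)..t, f s) (f t) t := fun t =>
    (hfc.integral_hasStrictDerivAt 0 t).hasDerivAt
  refine ⟨fun t => ∫ s in (0 : ℝ)..t, f s, y, ?_⟩
  refine
    { Phi_C1 := (contDiffOn_one_of_hasDerivWithinAt hT' hfc.continuousOn
        fun t _ => (hder t).hasDerivWithinAt).mono hsub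
      Phi_nonneg := fun t ht => intervalIntegral.integral_nonneg ht.1 fun s _ =>
        hadm.riccatiF_nonneg (hy _ (projIcc 0 (T + 1) hT'.le s).2).1
      Phi_zero := intervalIntegral.integral_same
      Phi_eq := fun t ht => ?_
      psi₁_cont := (continuous_imagOrbit S u₁.2).continuousOn
      psi₁_mem := fun t _ => imagOrbit_mem S u₁.2 t
      psi₁_zero := ?_
      psi₁_eq := fun t ht => imagOrbit_mild hA hu₁ ht.1.le
      psi₂_C1 := (contDiffOn_one_of_hasDerivWithinAt hT' (hfield.continuousOn_comp hyc
        fun t ht => (hy t ht).1) fun t ht => (hy t ht).2).mono hsub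
      psi₂_mem := fun t ht => (hy t (hsub ht)).1
      psi₂_zero := hy0
      psi₂_eq := fun t ht => (hy t (hsub (Ioc_subset_Icc_self ht))).2.mono hsub }
  · have h1 := (hder t).hasDerivWithinAt (s := Icc 0 T)
    have h2 : f t = riccatiF b m (y t) := by
      simp only [hf, projIcc_of_mem hT'.le (hsub (Ioc_subset_Icc_self ht))]
    rwa [h2] at h1
  · have h1 : u₁.1 = 0 := hu₁
    ext
    · exact h1.symm
    · simp [imagOrbit, S.evol_of_nonpos le_rfl, ContinuousLinearMap.adjoint_id]

end MildSolution

end AffineVol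

theorem proposition3p2 {H : Type*} [NormedAddCommGroup H] [InnerProductSpace ℝ H] [CompleteSpace H]
    [TopologicalSpace.SeparableSpace H]
    (b : AffineVol.SHS H) (B : AffineVol.SHS H →L[ℝ] AffineVol.SHS H)
    (m : Measure (AffineVol.Jump H)) (μ : VectorMeasure (AffineVol.Jump H) (AffineVol.SHS H))
    (hadm : AffineVol.IsAdmissible b B m μ)
    (S : AffineVol.C0Semigroup H) (A : H →ₗ.[ℝ] H) (hA : S.IsGenerator A)
    (D : H →L[ℝ] H) (hD : D.IsPositive)
    (u₁ : AffineVol.Cplx H) (hu₁ : u₁ ∈ AffineVol.imag H)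
    (u₂ : AffineVol.SHS H) (hu₂ : u₂ ∈ AffineVol.posCone H)
    (T : ℝ) (hT : 0 ≤ T) :
    ∃ (Φ : ℝ → ℝ) (ψ₁ : ℝ → AffineVol.Cplx H) (ψ₂ : ℝ → AffineVol.SHS H),
      AffineVol.IsMildSolution b B m μ A D u₁ u₂ T Φ ψ₁ ψ₂ ∧
      (∀ t ∈ Icc 0 T, ψ₁ t = -AffineVol.mulI (AffineVol.extend
        (ContinuousLinearMap.adjoint (S.toFun t.toNNReal)) (AffineVol.mulI u₁))) ∧
      ∀ (Φ' : ℝ → ℝ) (ψ₁' : ℝ → AffineVol.Cplx H) (ψ₂' : ℝ → AffineVol.SHS H),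
        AffineVol.IsMildSolution b B m μ A D u₁ u₂ T Φ' ψ₁' ψ₂' →
          EqOn Φ' Φ (Icc 0 T) ∧ EqOn ψ₁' ψ₁ (Icc 0 T) ∧ EqOn ψ₂' ψ₂ (Icc 0 T) := by
  obtain ⟨Φ, ψ₂, h⟩ := AffineVol.exists_isMildSolution hadm hA D hu₁ hu₂ hT
  exact ⟨Φ, _, ψ₂, h, fun t _ => AffineVol.imagOrbit_eq S hu₁ t,
    fun _ _ _ h' => h'.eqOn h hadm hA hT⟩
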